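/- Let $n\ge 2$ be even. The Fisher graph $F_n$ on the $n\times n$ torus is obtained from the square grid on the torus by replacing each grid vertex $(x,y)\in(\mathbb Z/n)^2$ by a gadget with six vertices $R,L,U,D,p,q$ and seven edges: the sides of the triangles $\{R,U,p\}$ and $\{L,D,q\}$, and the edge $pq$. The vertex $R$ at $(x,y)$ is joined to $L$ at $(x+1,y)$ (horizontal edges) and $U$ at $(x,y)$ to $D$ at $(x,y+1)$ (vertical edges). The horizontal and vertical edges (those parallel to $\gamma_x,\gamma_y$ below) carry arbitrary weights in the open interval $(0,1)$, and all other edges carry weight $1$. Orient the edges by a translation-invariant (with respect to all translations of the grid) clockwise odd orientation: on the boundary of each face (the two triangles of each gadget and the dodecagon in each square of the grid) an odd number of edges point along the boundary when it is traversed clockwise, where in the plane $R,L,U,D$ lie to the east, west, north, south of the centre of the gadget, $p$ to the north-east and $q$ to the south-west. Let $\gamma_x$ (respectively $\gamma_y$) be the closed path in the dual graph winding once around the torus horizontally between rows $n-1$ and $0$ (respectively vertically between columns $n-1$ and $0$). For $z,w\in\mathbb C^*$, let $K(z,w)$ be the matrix indexed by the vertices of $F_n$ in which an edge of weight $W$ oriented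 from $u$ to $v$ gives $K_{u,v}=W$ and $K_{v,u}=-W$, where in addition, if the edge is crossed by $\gamma_x$, the entry $K_{u,v}$ is multiplied by $z$ and $K_{v,u}$ by $1/z$, and similarly with $w$ if the edge is crossed by $\gamma_y$; all other entries are $0$. Put $P(z,w)=\det K(z,w)$. The spectral curve is $\{(z,w)\in(\mathbb C^*)^2 : P(z,w)=0\}$. A real node of it on $\mathbb T^2=\{|z|=|w|=1\}$ is a point $(z,w)\in\{(\pm1,\pm1)\}$ at which $P$, $\partial P/\partial z$ and $\partial P/\partial w$ all vanish. Then the only possible real node of the spectral curve on $\mathbb T^2$ is $(1,1)$. Moreover, if the vertices are numbered gadget by gadget (the gadgets in lexicographic order of $(x,y)$ with $0\le x,y<n$, and within each gadget in the order $R,L,U,D,p,q$), then these three matrices have positive Pfaffians: $$\mathrm{Pf}\,K(1,-1)>0,\qquad \mathrm{Pf}\,K(-1,1)>0,\qquad \mathrm{Pf}\,K(-1,-1)>0 .$$ -/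

import Mathlib

open scoped ComplexOrder

/-- The six vertices of the gadget that replaces a vertex of the square grid: `R`, `L`, `U`, `D`
are attached to the grid edges leaving to the right, left, top and bottom; `p` and `q` are the two
ends of the inner edge joining the triangles `{R, U, p}` and `{L, D, q}`. -/
inductive FisherCorner where
  | R | L | U | D | p | q
  deriving DecidableEq

instance FisherCorner.instFintype : Fintype FisherCorner where
  elems := {.R, .L, .U, .D, .p, .q}
  complete c := by cases c <;> decide

/-- The nine edges of the Fisher graph belonging to one site: `hor` and `ver` are the edges coming
from the horizontal and the vertical edge of the square grid, `mid` is the edge `p q`, the other six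
are the sides of the two triangles. -/
inductive FisherKind where
  | hor | ver | mid | ur | rp | pu | dl | lq | qd
  deriving DecidableEq

instance FisherKind.instFintype : Fintype FisherKind where
  elems := {.hor, .ver, .mid, .ur, .rp, .pu, .dl, .lq, .qd}
  complete k := by cases k <;> decide

namespace FisherKind

/-- The first end of an edge, at the site of the edge. -/
def fst : FisherKind → FisherCorner
  | hor => .R
  | ver => .U
  | mid => .p
  | ur => .U
  | rp => .R
  | pu => .p
  | dl => .D
  | lq => .L
  | qd => .q

/-- The second end of an edge: at the site to the right for `hor`, at the site above for `ver`,
at the same site otherwise. -/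
def snd : FisherKind → FisherCorner
  | hor => .L
  | ver => .D
  | mid => .q
  | ur => .R
  | rp => .p
  | pu => .U
  | dl => .L
  | lq => .q
  | qd => .D

end FisherKind

/-- Translation-invariant orientations of the Fisher graph: `o k = true` means that every edge of
kind `k` points from its first to its second end. -/
abbrev FisherOrientation := FisherKind → Bool

/-- The faces of the Fisher graph up to translation: two triangles and a dodecagon. -/
inductive FisherFace where
  | triangleRU | triangleLD | dodecagon

/-- The boundary of a face traversed clockwise, as a list of edges; the flag tells whether the edge
is traversed from its first to its second end. With the gadget drawn in the plane (`R` to the east,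
`U` to the north, `p` to the north-east, and so on), the vertices visited are `U R p U` and `D L q D`
for the triangles, and `U, D q p R, L D, U p q L, R U` for the dodecagon inside a square of the
grid (at the lower left, upper left, upper right, lower right and lower left corner). -/
def FisherFace.boundary : FisherFace → List (FisherKind × Bool)
  | triangleRU => [(.ur, true), (.rp, true), (.pu, true)]
  | triangleLD => [(.dl, true), (.lq, true), (.qd, true)]
  | dodecagon =>
    [(.ver, true), (.qd, false), (.mid, false), (.rp, false), (.hor, true), (.dl, false),
      (.ver, false), (.pu, false), (.mid, true), (.lq, false), (.hor, false), (.ur, false)]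

/-- Clockwise odd: around each face an odd number of edges point along the clockwise traversal. -/
def FisherOrientation.ClockwiseOdd (o : FisherOrientation) : Prop :=
  ∀ f : FisherFace, Odd (f.boundary.countP fun e => o e.1 == e.2)

/-- Vertices of the Fisher graph on the `n × n` torus: column, row, corner. -/
abbrev FisherVertex (n : ℕ) := Fin n × Fin n × FisherCorner

/-- Edges of the Fisher graph on the `n × n` torus: column, row, kind. -/
abbrev FisherEdge (n : ℕ) := Fin n × Fin n × FisherKind

namespace FisherEdge

variable {n : ℕ} [NeZero n]

/-- First end of an edge. -/
def fst (e : FisherEdge n) : FisherVertex n := (e.1, e.2.1, e.2.2.fst)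

/-- Second end of an edge; addition in `Fin n` is modulo `n`. -/
def snd (e : FisherEdge n) : FisherVertex n :=
  match e with
  | (x, y, .hor) => (x + 1, y, FisherKind.hor.snd)
  | (x, y, .ver) => (x, y + 1, FisherKind.ver.snd)
  | (x, y, k) => (x, y, k.snd)

/-- The vertex an oriented edge starts from. -/
def tail (o : FisherOrientation) (e : FisherEdge n) : FisherVertex n :=
  if o e.2.2 then e.fst else e.snd

/-- The vertex an oriented edge points to. -/
def head (o : FisherOrientation) (e : FisherEdge n) : FisherVertex n :=
  if o e.2.2 then e.snd else e.fst

/-- Edge weights: `a x y` on the horizontal edge from site `(x, y)` to site `(x + 1, y)`, `b x y` on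
the vertical edge from `(x, y)` to `(x, y + 1)`, and `1` on all other edges. -/
def weight (a b : Fin n → Fin n → ℝ) (e : FisherEdge n) : ℝ :=
  match e with
  | (x, y, .hor) => a x y
  | (x, y, .ver) => b x y
  | _ => 1

/-- `γ_x` is the horizontal dual closed path between the top and the bottom row; the edges it
crosses get the factor `z`. `γ_y` is the vertical dual closed path between the last and the first
column; the edges it crosses get the factor `w`. -/
def monodromy (z w : ℂ) (e : FisherEdge n) : ℂ :=
  match e with
  | (x, _, .hor) => if x + 1 = 0 then w else 1
  | (_, y, .ver) => if y + 1 = 0 then z else 1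
  | _ => 1

end FisherEdge

section Kasteleyn

variable {n : ℕ} [NeZero n]

/-- The Kasteleyn matrix `K(z, w)`: an edge `u → v` of weight `W` contributes `W` to the entry
`(u, v)` and `-W` to the entry `(v, u)`; on an edge crossed by `γ_x` the former is multiplied by `z`
and the latter by `1 / z`, and similarly with `w` for `γ_y`. -/
noncomputable def fisherKasteleyn (o : FisherOrientation) (a b : Fin n → Fin n → ℝ) (z w : ℂ) :
    Matrix (FisherVertex n) (FisherVertex n) ℂ :=
  fun u v => ∑ e : FisherEdge n,
    ((if u = e.tail o ∧ v = e.head o then (e.weight a b : ℂ) * e.monodromy z w else 0) -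
      (if v = e.tail o ∧ u = e.head o then (e.weight a b : ℂ) * (e.monodromy z w)⁻¹ else 0))

/-- The characteristic polynomial `P(z, w) = det K(z, w)`; the spectral curve is its zero locus in
`ℂ* × ℂ*`. -/
noncomputable def fisherCharPoly (o : FisherOrientation) (a b : Fin n → Fin n → ℝ) (z w : ℂ) : ℂ :=
  (fisherKasteleyn o a b z w).det

end Kasteleyn

/-- A real node on the unit torus of the curve `P = 0`: a point of the torus with real coordinates
(that is, one of `(±1, ±1)`) where `P` and both its partial derivatives vanish. -/
def IsRealNode (P : ℂ → ℂ → ℂ) (z w : ℂ) : Prop :=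
  ‖z‖ = 1 ∧ ‖w‖ = 1 ∧ z.im = 0 ∧ w.im = 0 ∧
    P z w = 0 ∧ deriv (fun t => P t w) z = 0 ∧ deriv (fun t => P z t) w = 0

/-- The Pfaffian of a skew-symmetric matrix of even size. -/
noncomputable def pfaffian {N : ℕ} (A : Matrix (Fin (2 * N)) (Fin (2 * N)) ℂ) : ℂ :=
  ((2 ^ N * N.factorial : ℕ) : ℂ)⁻¹ *
    ∑ s : Equiv.Perm (Fin (2 * N)), ((Equiv.Perm.sign s : ℤ) : ℂ) *
      ∏ i : Fin N, A (s ⟨2 * i, by omega⟩) (s ⟨2 * i + 1, by omega⟩)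

/-- The order `R, L, U, D, p, q` of the vertices at a site. -/
def fisherCornerEquiv : FisherCorner ≃ Fin 6 where
  toFun
    | .R => 0
    | .L => 1
    | .U => 2
    | .D => 3
    | .p => 4
    | .q => 5
  invFun := ![.R, .L, .U, .D, .p, .q]
  left_inv c := by cases c <;> rfl
  right_inv i := by fin_cases i <;> rfl

/-- The lexicographic numbering of the vertices; the six vertices of a site are consecutive. -/
def fisherEnum (n : ℕ) : FisherVertex n ≃ Fin (2 * (3 * n * n)) :=
  ((Equiv.refl (Fin n)).prodCongr
      (((Equiv.refl (Fin n)).prodCongr fisherCornerEquiv).trans finProdFinEquiv)).trans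
    (finProdFinEquiv.trans (finCongr (by ring)))

/-- The Pfaffian of `K(z, w)` (skew-symmetric for `z, w ∈ {1, -1}`), with the vertices numbered site
by site. -/
noncomputable def fisherPf {n : ℕ} [NeZero n] (o : FisherOrientation) (a b : Fin n → Fin n → ℝ)
    (z w : ℂ) : ℂ :=
  pfaffian ((fisherKasteleyn o a b z w).reindex (fisherEnum n) (fisherEnum n))

/-! ### Pfaffians: congruence, degeneracy, and expansion over sets of edges. -/

section PfaffianExpansion

open Finset Matrix

/-! Write z = (-1)^ζ and w = (-1)^ξ and expand Pf K(z, w) over perfect matchings of the Fisher graph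
(`pfaffian_eq_sum_pairingSign`). A perfect matching is determined by the grid edges it contains, and
these form an arbitrary even subgraph of the torus (`IsPerfect.exists_matching`,
`GridChain.IsEven.isPerfect_matching`). What remains is the sign, computed as an exponent in `ZMod
2`. The inversions of the matching give local terms, which cancel after summation over the torus,
and wrap-around terms, which add up to i + j + ij for a subgraph of homology class (i, j)
(`GridChain.signExponent_matching`). The orientation signs cancel because n is even
(`GridChain.sum_orientation`), and the monodromy contributes ξi + ζj. Hence, with Z_ij > 0 the
partition function of even subgraphs of class (i, j), Pf K is the sum of (-1)^(i + j + ij + ξi + ζj)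
Z_ij (`fisherPf_eq_sum_partition`).

At each of the points (1, -1), (-1, 1), (-1, -1) exactly one class has a minus sign, and it is not
(0, 0). Even subgraphs are domain walls of Ising spins on the faces. Weights in (0, 1) make the
spins ferromagnetic, and passing from class (0, 0) to (i, j) reverses couplings along one row or
column (or both), so Griffiths' inequality gives Z_ij ≤ Z_00 (`GridChain.partition_le`). The
negative term is therefore compensated and the Pfaffian is positive (`fisherPf_pos`).

A skew-symmetric matrix of determinant zero has Pfaffian zero (`pfaffian_eq_zero_of_det_eq_zero`),
so P does not vanish at these three points and (1, 1) is the only candidate for a real node. -/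

theorem Fin.prod_univ_two_mul {R : Type*} [CommMonoid R] {N : ℕ} (g : Fin (2 * N) → R) :
    ∏ m, g m = ∏ i : Fin N, g ⟨2 * i, by omega⟩ * g ⟨2 * i + 1, by omega⟩ := by
  induction N with
  | zero => simp
  | succ N ih =>
    have h : ∏ m, g m = ∏ m : Fin (2 * N + 1 + 1), g m := rfl
    rw [h, Fin.prod_univ_castSucc, Fin.prod_univ_castSucc, Fin.prod_univ_castSucc, mul_assoc]
    congr 1
    exact ih fun m => g ⟨m, by omega⟩

/-- The sign of the order of two elements, `0` if they are equal. -/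
noncomputable def orderSign {α : Type*} [LinearOrder α] (u v : α) : ℂ :=
  if u < v then 1 else if v < u then -1 else 0

theorem orderSign_self {α : Type*} [LinearOrder α] (u : α) : orderSign u u = 0 := by
  simp [orderSign]

theorem orderSign_swap {α : Type*} [LinearOrder α] (u v : α) :
    orderSign u v = -orderSign v u := by
  rcases lt_trichotomy u v with h | h | h
  · simp [orderSign, h, h.not_gt]
  · simp [orderSign, h]
  · simp [orderSign, h, h.not_gt]

/-- The sign of a map into a linear order, as a product over pairs; it vanishes unless the map is
injective. -/
theorem det_one_submatrix_eq_prod_orderSign {n : ℕ} (F : Fin n → Fin n) :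
    ((1 : Matrix (Fin n) (Fin n) ℂ).submatrix id F).det =
      ∏ m, ∏ m', if m < m' then orderSign (F m) (F m') else 1 := by
  by_cases hF : Function.Injective F
  · let σ : Equiv.Perm (Fin n) := Equiv.ofBijective F (Finite.injective_iff_bijective.1 hF)
    have hσ : F = σ := rfl
    rw [hσ, det_permute', det_one, mul_one, Equiv.Perm.sign_eq_prod_prod_Ioi]
    push_cast
    refine prod_congr rfl fun m _ => ?_
    rw [← prod_filter]
    refine prod_congr (by ext; simp) fun m' hm' => ?_
    have hne : σ m ≠ σ m' := fun h => (mem_filter.1 hm').2.ne (σ.injective h)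
    rcases lt_or_gt_of_ne hne with h | h
    · simp [orderSign, h]
    · simp [orderSign, h, h.not_gt]
  · obtain ⟨a, b, hab, hne⟩ : ∃ a b, F a = F b ∧ a ≠ b := by
      simpa [Function.Injective] using hF
    rw [det_zero_of_column_eq hne fun i => by rw [submatrix_apply, submatrix_apply, hab]]
    rcases lt_or_gt_of_ne hne with h | h
    · refine (prod_eq_zero (mem_univ a) (prod_eq_zero (mem_univ b) ?_)).symm
      simp [h, hab, orderSign_self]
    · refine (prod_eq_zero (mem_univ b) (prod_eq_zero (mem_univ a) ?_)).symm
      simp [h, hab, orderSign_self]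

/-- The sequence `f 0, g 0, f 1, g 1, …`. -/
def interleave {α : Type*} {N : ℕ} (f g : Fin N → α) (m : Fin (2 * N)) : α :=
  if m.1 % 2 = 0 then f ⟨m / 2, by omega⟩ else g ⟨m / 2, by omega⟩

theorem interleave_even {α : Type*} {N : ℕ} (f g : Fin N → α) (i : Fin N) :
    interleave f g ⟨2 * i, by omega⟩ = f i := by
  simp [interleave]

theorem interleave_odd {α : Type*} {N : ℕ} (f g : Fin N → α) (i : Fin N) :
    interleave f g ⟨2 * i + 1, by omega⟩ = g i := by
  have h : (2 * (i : ℕ) + 1) / 2 = i := by omega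
  simp [interleave, Nat.add_mod, h]

/-- The sign with which two pairs cross: the product of the order signs between their ends. -/
noncomputable def crossSign {α : Type*} [LinearOrder α] (u v u' v' : α) : ℂ :=
  orderSign u u' * orderSign u v' * (orderSign v u' * orderSign v v')

theorem crossSign_swap {α : Type*} [LinearOrder α] (u v u' v' : α) :
    crossSign u v u' v' = crossSign u' v' u v := by
  simp only [crossSign]
  rw [orderSign_swap u' u, orderSign_swap v' u, orderSign_swap u' v, orderSign_swap v' v]
  ring

/-- The pairs of positions m < m' are grouped by the blocks {2i, 2i + 1} containing them. One block
contributes the order within the pair, two different blocks contribute four comparisons. -/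
theorem det_one_submatrix_interleave {N : ℕ} (f g : Fin N → Fin (2 * N)) :
    ((1 : Matrix (Fin (2 * N)) (Fin (2 * N)) ℂ).submatrix id (interleave f g)).det =
      (∏ i, orderSign (f i) (g i)) *
        ∏ i, ∏ j, if i < j then crossSign (f i) (g i) (f j) (g j) else 1 := by
  rw [det_one_submatrix_eq_prod_orderSign, Fin.prod_univ_two_mul, ← prod_mul_distrib]
  refine prod_congr rfl fun i _ => ?_
  rw [Fin.prod_univ_two_mul, Fin.prod_univ_two_mul, ← prod_mul_distrib]
  have h1 : orderSign (f i) (g i) = ∏ j, if i = j then orderSign (f i) (g i) else 1 := by simp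
  rw [h1, ← prod_mul_distrib]
  refine prod_congr rfl fun j _ => ?_
  simp only [interleave_even, interleave_odd, Fin.mk_lt_mk]
  rcases lt_trichotomy i j with h | h | h
  · have h' : i.1 < j.1 := h
    rw [if_pos (by omega), if_pos (by omega), if_pos (by omega), if_pos (by omega),
      if_neg h.ne, if_pos h, crossSign, one_mul]
  · subst h
    simp
  · have h' : j.1 < i.1 := h
    rw [if_neg (by omega), if_neg (by omega), if_neg (by omega), if_neg (by omega),
      if_neg h.ne', if_neg h.not_gt]
    simp

/-- Expansion of the unnormalized Pfaffian of a sum of decomposable matrices. -/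
theorem sum_perm_prod_eq_sum_det {N : ℕ} {κ : Type*} [Fintype κ] (c : κ → ℂ)
    (f g : κ → Fin (2 * N)) (B : Matrix (Fin (2 * N)) (Fin (2 * N)) ℂ) :
    ∑ s : Equiv.Perm (Fin (2 * N)), ((Equiv.Perm.sign s : ℤ) : ℂ) *
      ∏ i : Fin N, ∑ k, c k * (B (s ⟨2 * i, by omega⟩) (f k) * B (s ⟨2 * i + 1, by omega⟩) (g k)) =
    ∑ φ : Fin N → κ, (∏ i, c (φ i)) *
      (B.submatrix id (interleave (fun i => f (φ i)) fun i => g (φ i))).det := by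
  classical
  simp_rw [prod_univ_sum, Fintype.piFinset_univ, mul_sum, prod_mul_distrib]
  rw [sum_comm]
  refine sum_congr rfl fun φ _ => ?_
  rw [det_apply', mul_sum]
  refine sum_congr rfl fun s _ => ?_
  rw [Fin.prod_univ_two_mul]
  simp only [submatrix_apply, id, interleave_even, interleave_odd, prod_mul_distrib]
  ring

/-- The expansion `sum_perm_prod_eq_sum_det` is applied to B and to the identity. Selecting columns
of B is multiplying B by the same selection of columns of the identity, so det B factors out of
every term. -/
theorem pfaffian_congr_mul {N : ℕ} (A B : Matrix (Fin (2 * N)) (Fin (2 * N)) ℂ) :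
    pfaffian (B * A * Bᵀ) = B.det * pfaffian A := by
  have h1 := sum_perm_prod_eq_sum_det (fun k : Fin (2 * N) × Fin (2 * N) => A k.1 k.2)
    Prod.fst Prod.snd B
  have h2 := sum_perm_prod_eq_sum_det (fun k : Fin (2 * N) × Fin (2 * N) => A k.1 k.2)
    Prod.fst Prod.snd 1
  have e1 : ∀ u v, ∑ k : Fin (2 * N) × Fin (2 * N), A k.1 k.2 * (B u k.1 * B v k.2) =
      (B * A * Bᵀ) u v := by
    intro u v
    simp only [mul_apply, transpose_apply, Fintype.sum_prod_type, sum_mul]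
    rw [sum_comm]
    exact sum_congr rfl fun _ _ => sum_congr rfl fun _ _ => by ring
  have e2 : ∀ u v, ∑ k : Fin (2 * N) × Fin (2 * N), A k.1 k.2 *
      ((1 : Matrix (Fin (2 * N)) (Fin (2 * N)) ℂ) u k.1 *
        (1 : Matrix (Fin (2 * N)) (Fin (2 * N)) ℂ) v k.2) = A u v := by
    intro u v
    simp [Fintype.sum_prod_type, one_apply]
  simp only [e1] at h1
  simp only [e2] at h2
  rw [pfaffian, pfaffian, h1, h2, mul_left_comm, mul_sum (a := B.det)]
  congr 1
  refine sum_congr rfl fun φ _ => ?_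
  rw [mul_left_comm, ← det_mul]
  congr 2
  ext u v
  simp [mul_apply, one_apply]

theorem pfaffian_eq_zero_of_row {N : ℕ} (A : Matrix (Fin (2 * N)) (Fin (2 * N)) ℂ)
    (k : Fin (2 * N)) (hr : ∀ j, A k j = 0) (hc : ∀ j, A j k = 0) : pfaffian A = 0 := by
  rw [pfaffian, sum_eq_zero, mul_zero]
  intro s _
  obtain ⟨m, rfl⟩ := s.surjective k
  rcases Nat.mod_two_eq_zero_or_one m with hm | hm
  · rw [prod_eq_zero (mem_univ (⟨m / 2, by omega⟩ : Fin N)), mul_zero]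
    convert hr _ using 3
    ext
    simp only
    omega
  · rw [prod_eq_zero (mem_univ (⟨m / 2, by omega⟩ : Fin N)), mul_zero]
    convert hc _ using 3
    ext
    simp only
    omega

/-- Take v ≠ 0 with vA = 0 and v k ≠ 0, and let B be the identity with row k replaced by v. Then det
B = v k ≠ 0, while row k and, by skew-symmetry, column k of the congruent matrix vanish. -/
theorem pfaffian_eq_zero_of_det_eq_zero {N : ℕ} (A : Matrix (Fin (2 * N)) (Fin (2 * N)) ℂ)
    (hA : Aᵀ = -A) (hdet : A.det = 0) : pfaffian A = 0 := by
  obtain ⟨v, hv, hvA⟩ := exists_vecMul_eq_zero_iff.2 hdet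
  obtain ⟨k, hk⟩ := Function.ne_iff.1 hv
  set B : Matrix (Fin (2 * N)) (Fin (2 * N)) ℂ := updateRow 1 k v with hB
  have hdetB : B.det = v k := by
    rw [hB, ← cramer_transpose_apply, transpose_one, cramer_one]
    rfl
  have hBA : ∀ j, (B * A) k j = 0 := by
    intro j
    have h := congrFun hvA j
    simpa [mul_apply, hB, vecMul, dotProduct] using h
  have hskew : (B * A * Bᵀ)ᵀ = -(B * A * Bᵀ) := by
    rw [transpose_mul, transpose_mul, transpose_transpose, hA, ← Matrix.mul_assoc]
    simp
  have hr : ∀ j, (B * A * Bᵀ) k j = 0 := fun j => by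
    rw [mul_apply]
    exact sum_eq_zero fun i _ => by rw [hBA, zero_mul]
  have hc : ∀ j, (B * A * Bᵀ) j k = 0 := fun j => by
    have h := congrFun (congrFun hskew k) j
    rw [transpose_apply, neg_apply, hr, neg_zero] at h
    exact h
  have h := pfaffian_congr_mul A B
  rw [pfaffian_eq_zero_of_row _ k hr hc, hdetB] at h
  exact (mul_eq_zero.1 h.symm).resolve_left hk

/-- In a product over unordered pairs the choice of an order in each pair is irrelevant. -/
theorem prod_tournament_congr {ι R : Type*} [CommMonoid R] (s : Finset ι)
    (r r' : ι → ι → Prop) [DecidableRel r] [DecidableRel r']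
    (hr : ∀ a b, r a b → ¬ r b a) (hr' : ∀ a b, r' a b → ¬ r' b a)
    (ht : ∀ a b, a ≠ b → r a b ∨ r b a) (ht' : ∀ a b, a ≠ b → r' a b ∨ r' b a)
    (F : ι → ι → R) (hF : ∀ a b, F a b = F b a) :
    ∏ a ∈ s, ∏ b ∈ s, (if r a b then F a b else 1) =
      ∏ a ∈ s, ∏ b ∈ s, if r' a b then F a b else 1 := by
  classical
  rw [← prod_product', ← prod_product', ← prod_filter, ← prod_filter]
  -- Each unordered pair has exactly one ordering admitted by `r` and one admitted by `r'`; swapping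
  -- where necessary gives mutually inverse maps. Stating this for general `r`, `r'` serves both
  -- directions.
  have key : ∀ (r r' : ι → ι → Prop) [DecidableRel r] [DecidableRel r'], (∀ a b, r a b → ¬ r b a) →
      (∀ a b, a ≠ b → r' a b ∨ r' b a) → ∀ p : ι × ι, r p.1 p.2 →
      r' (if r' p.1 p.2 then p else p.swap).1 (if r' p.1 p.2 then p else p.swap).2 ∧
      (if r (if r' p.1 p.2 then p else p.swap).1 (if r' p.1 p.2 then p else p.swap).2
        then (if r' p.1 p.2 then p else p.swap) else (if r' p.1 p.2 then p else p.swap).swap) = p := by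
    intro r r' _ _ hr ht' p hp
    have hne : p.1 ≠ p.2 := fun h => by
      have h1 := hp
      rw [h] at h1
      exact hr _ _ h1 h1
    have h2 := ht' _ _ hne
    have h3 := hr _ _ hp
    by_cases h : r' p.1 p.2
    · simp [h, hp]
    · simp [h, h3, h2.resolve_left h]
  refine prod_nbij' (fun p => if r' p.1 p.2 then p else p.swap)
    (fun p => if r p.1 p.2 then p else p.swap) ?_ ?_ ?_ ?_ ?_
  · intro p hp
    simp only [mem_filter, mem_product] at hp ⊢
    refine ⟨?_, (key r r' hr ht' p hp.2).1⟩
    split_ifs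
    · exact hp.1
    · exact hp.1.symm
  · intro p hp
    simp only [mem_filter, mem_product] at hp ⊢
    refine ⟨?_, (key r' r hr' ht p hp.2).1⟩
    split_ifs
    · exact hp.1
    · exact hp.1.symm
  · intro p hp
    exact (key r r' hr ht' p (mem_filter.1 hp).2).2
  · intro p hp
    exact (key r' r hr' ht p (mem_filter.1 hp).2).2
  · intro p _
    split_ifs
    · rfl
    · exact hF _ _

/-- The sign of a set of pairs of points on a line, the order within the pairs and the number of
crossings being taken into account; it vanishes unless the pairs are disjoint. -/
noncomputable def pairingSign {ι α : Type*} [LinearOrder α] (r : ι → ι → Prop) [DecidableRel r]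
    (f g : ι → α) (M : Finset ι) : ℂ :=
  (∏ e ∈ M, orderSign (f e) (g e)) *
    ∏ e ∈ M, ∏ e' ∈ M, if r e e' then crossSign (f e) (g e) (f e') (g e') else 1

theorem prod_lt_crossSign_eq_pairingSign {ι α : Type*} [LinearOrder α] [DecidableEq ι]
    (r : ι → ι → Prop) [DecidableRel r] (hr : ∀ a b, r a b → ¬ r b a)
    (ht : ∀ a b, a ≠ b → r a b ∨ r b a) {N : ℕ} (f g : ι → α) (φ : Fin N → ι)
    (hφ : Function.Injective φ) :
    (∏ i, orderSign (f (φ i)) (g (φ i))) *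
        ∏ i, ∏ j, (if i < j then crossSign (f (φ i)) (g (φ i)) (f (φ j)) (g (φ j)) else 1) =
      pairingSign r f g (univ.image φ) := by
  rw [pairingSign, prod_image fun _ _ _ _ h => hφ h, prod_image fun _ _ _ _ h => hφ h]
  simp_rw [prod_image fun _ _ _ _ h => hφ h]
  congr 1
  exact prod_tournament_congr univ (· < ·) (fun i j => r (φ i) (φ j))
    (fun a b h => h.not_gt) (fun a b h => hr _ _ h) (fun a b h => lt_or_gt_of_ne h)
    (fun a b h => ht _ _ (hφ.ne h)) _ fun a b => crossSign_swap _ _ _ _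

/-- This counts the orderings of a set of edges and accounts for the factor N! in the normalization
of the Pfaffian. -/
theorem card_injective_image_eq {ι : Type*} [Fintype ι] [DecidableEq ι] {N : ℕ} (M : Finset ι)
    (hM : M.card = N) :
    (univ.filter fun φ : Fin N → ι => Function.Injective φ ∧ univ.image φ = M).card =
      N.factorial := by
  have e : Fin N ≃ M := (finCongr hM.symm).trans M.equivFin.symm
  have h : Fintype.card (Fin N ≃ M) = N.factorial := by
    rw [Fintype.card_equiv e, Fintype.card_fin]
  rw [← h, ← Finset.card_univ]
  symm
  refine card_bij (fun ψ _ i => (ψ i : ι)) ?_ ?_ ?_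
  · intro ψ _
    refine mem_filter.2 ⟨mem_univ _, fun i j hij => ψ.injective (Subtype.ext hij), ?_⟩
    ext a
    simp only [mem_image, mem_univ, true_and]
    exact ⟨fun ⟨i, hi⟩ => hi ▸ (ψ i).2, fun ha => ⟨ψ.symm ⟨a, ha⟩, by simp⟩⟩
  · intro ψ _ ψ' _ h
    ext i
    exact congrFun h i
  · intro φ hφ
    obtain ⟨hinj, him⟩ := (mem_filter.1 hφ).2
    have hmem : ∀ i, φ i ∈ M := fun i => him ▸ mem_image_of_mem _ (mem_univ _)
    refine ⟨Equiv.ofBijective (fun i => ⟨φ i, hmem i⟩) ⟨fun i j hij => hinj (congrArg Subtype.val hij),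
      fun a => ?_⟩, mem_univ _, rfl⟩
    have ha : (a : ι) ∈ univ.image φ := him ▸ a.2
    obtain ⟨i, _, hi⟩ := mem_image.1 ha
    exact ⟨i, Subtype.ext hi⟩

/-- The Pfaffian of a weighted oriented graph as a signed sum over sets of edges. -/
theorem pfaffian_eq_sum_pairingSign {N : ℕ} {ι : Type*} [Fintype ι] [DecidableEq ι]
    (r : ι → ι → Prop) [DecidableRel r] (hr : ∀ a b, r a b → ¬ r b a)
    (ht : ∀ a b, a ≠ b → r a b ∨ r b a) (c : ι → ℂ) (f g : ι → Fin (2 * N))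
    (A : Matrix (Fin (2 * N)) (Fin (2 * N)) ℂ)
    (hA : ∀ u v, A u v = ∑ e, c e * ((if u = f e ∧ v = g e then 1 else 0) -
      if v = f e ∧ u = g e then 1 else 0)) :
    pfaffian A = ∑ M : Finset ι with M.card = N, pairingSign r f g M * ∏ e ∈ M, c e := by
  -- Every edge is used in both directions, recorded by the Boolean; this puts `A` in the
  -- decomposable form of `sum_perm_prod_eq_sum_det`.
  have hA' : ∀ u v, A u v = ∑ k : ι × Bool, (if k.2 then c k.1 else -c k.1) *
      ((1 : Matrix (Fin (2 * N)) (Fin (2 * N)) ℂ) u (if k.2 then f k.1 else g k.1) *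
        (1 : Matrix (Fin (2 * N)) (Fin (2 * N)) ℂ) v (if k.2 then g k.1 else f k.1)) := by
    intro u v
    rw [hA, Fintype.sum_prod_type]
    refine sum_congr rfl fun e _ => ?_
    rw [Fintype.sum_bool]
    simp only [one_apply, ite_and, if_true]
    simp only [Bool.false_eq_true, if_false]
    split_ifs <;> ring
  have hfact : ((2 ^ N * N.factorial : ℕ) : ℂ) ≠ 0 := by
    exact_mod_cast (Nat.mul_pos (by positivity) N.factorial_pos).ne'
  rw [pfaffian, inv_mul_eq_iff_eq_mul₀ hfact]
  simp only [hA']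
  rw [sum_perm_prod_eq_sum_det]
  -- Reversing an edge negates both its coefficient and its own order sign and leaves the crossing
  -- signs unchanged, so the directions drop out and later give the factor 2^N.
  have hdet : ∀ φ : Fin N → ι × Bool,
      (∏ i, (if (φ i).2 then c (φ i).1 else -c (φ i).1)) *
        ((1 : Matrix (Fin (2 * N)) (Fin (2 * N)) ℂ).submatrix id
          (interleave (fun i => if (φ i).2 then f (φ i).1 else g (φ i).1)
            fun i => if (φ i).2 then g (φ i).1 else f (φ i).1)).det =
      (∏ i, c (φ i).1) * ((∏ i, orderSign (f (φ i).1) (g (φ i).1)) *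
        ∏ i, ∏ j, if i < j then
          crossSign (f (φ i).1) (g (φ i).1) (f (φ j).1) (g (φ j).1) else 1) := by
    intro φ
    rw [det_one_submatrix_interleave, ← mul_assoc, ← mul_assoc]
    congr 1
    · rw [← prod_mul_distrib, ← prod_mul_distrib]
      refine prod_congr rfl fun i _ => ?_
      cases (φ i).2
      · simp only [Bool.false_eq_true, if_false]
        rw [orderSign_swap]
        ring
      · simp
    · refine prod_congr rfl fun i _ => prod_congr rfl fun j _ => ?_
      congr 1
      cases (φ i).2 <;> cases (φ j).2 <;> simp [crossSign] <;> ring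
  simp_rw [hdet]
  have hforget : ∀ G : (Fin N → ι) → ℂ,
      ∑ φ : Fin N → ι × Bool, G (fun i => (φ i).1) = 2 ^ N * ∑ φ : Fin N → ι, G φ := by
    intro G
    rw [← (Equiv.arrowProdEquivProdArrow (Fin N) (fun _ => ι) fun _ => Bool).symm.sum_comp,
      Fintype.sum_prod_type, mul_sum]
    refine sum_congr rfl fun φ _ => ?_
    simp [Equiv.arrowProdEquivProdArrow]
  rw [hforget fun φ => (∏ i, c (φ i)) * ((∏ i, orderSign (f (φ i)) (g (φ i))) *
        ∏ i, ∏ j, if i < j then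
          crossSign (f (φ i)) (g (φ i)) (f (φ j)) (g (φ j)) else 1)]
  -- A repeated edge meets itself and makes a crossing sign zero; otherwise the term depends only on
  -- the set of edges.
  have hterm : ∀ φ : Fin N → ι, (∏ i, c (φ i)) * ((∏ i, orderSign (f (φ i)) (g (φ i))) *
        ∏ i, ∏ j, if i < j then
          crossSign (f (φ i)) (g (φ i)) (f (φ j)) (g (φ j)) else 1) =
      if Function.Injective φ then
        pairingSign r f g (univ.image φ) * ∏ e ∈ univ.image φ, c e else 0 := by
    intro φ
    split_ifs with hφ
    · rw [prod_lt_crossSign_eq_pairingSign r hr ht f g φ hφ, prod_image fun _ _ _ _ h => hφ h]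
      ring
    · obtain ⟨a, b, hab, hne⟩ : ∃ a b, φ a = φ b ∧ a ≠ b := by
        simpa [Function.Injective] using hφ
      have hz : ∀ a b, φ a = φ b → a < b → (∏ i, ∏ j, if i < j then
          crossSign (f (φ i)) (g (φ i)) (f (φ j)) (g (φ j)) else 1) = 0 := by
        intro a b hab h
        refine prod_eq_zero (mem_univ a) (prod_eq_zero (mem_univ b) ?_)
        simp [h, hab, crossSign, orderSign_self]
      rcases lt_or_gt_of_ne hne with h | h
      · rw [hz a b hab h, mul_zero, mul_zero]
      · rw [hz b a hab.symm h, mul_zero, mul_zero]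
  simp_rw [hterm]
  rw [← sum_filter, ← sum_fiberwise_of_maps_to (s := univ.filter Function.Injective)
    (t := univ.filter fun M : Finset ι => M.card = N) (g := fun φ => univ.image φ)]
  · push_cast
    rw [mul_assoc, mul_sum (a := (N.factorial : ℂ))]
    congr 1
    refine sum_congr rfl fun M hM => ?_
    rw [← card_injective_image_eq M (mem_filter.1 hM).2, filter_filter, ← nsmul_eq_mul]
    refine sum_eq_card_nsmul fun φ hφ => ?_
    rw [(mem_filter.1 hφ).2.2]
  · intro φ hφ
    rw [mem_filter] at hφ ⊢
    exact ⟨mem_univ _, by rw [card_image_of_injective _ hφ.2, card_univ, Fintype.card_fin]⟩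

end PfaffianExpansion

/-! ### Partial sums modulo 2 around a cycle. -/

section CyclicSums

open Finset

theorem ZMod.two_add_self (a : ZMod 2) : a + a = 0 := CharTwo.add_self_eq_zero a

variable {n : ℕ} [NeZero n]

theorem Fin.val_add_one_cyclic (y : Fin n) :
    (y + 1).val = if y.val + 1 = n then 0 else y.val + 1 := by
  obtain ⟨m, rfl⟩ := Nat.exists_eq_succ_of_ne_zero (NeZero.ne n)
  rw [Fin.val_add_one]
  simp only [Fin.ext_iff, Fin.val_last]
  split_ifs <;> omega

theorem Fin.eq_neg_one_iff_val (y : Fin n) : y = -1 ↔ y.val + 1 = n := by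
  rw [eq_neg_iff_add_eq_zero, Fin.ext_iff, Fin.val_add_one_cyclic, Fin.val_zero]
  split_ifs with h <;> simp [h]

theorem Fin.eq_of_eq_sub_one {α : Type*} (F : Fin n → α) (hF : ∀ y, F y = F (y - 1)) (y : Fin n) :
    F y = F (-1) := by
  suffices h : ∀ k, ∀ y : Fin n, y.val = k → F y = F 0 by
    rw [h _ y rfl, hF 0, zero_sub]
  intro k
  induction k with
  | zero => exact fun y hy => congrArg F (Fin.ext hy)
  | succ k ih =>
    intro y hy
    rw [hF, ih]
    have h := Fin.val_add_one_cyclic (y - 1)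
    rw [sub_add_cancel, hy] at h
    split_ifs at h
    omega

/-- Crossing a point of the cyclic order when stepping forward by one. -/
theorem Fin.lt_add_add_one_lt (y' y : Fin n) :
    ((if y' < y then 1 else 0) + (if y' + 1 < y then 1 else 0) : ZMod 2) =
      (if y' + 1 = y then 1 else 0) + if y' = -1 then 1 else 0 := by
  simp only [Fin.eq_neg_one_iff_val]
  simp only [Fin.lt_def, Fin.ext_iff, Fin.val_add_one_cyclic]
  have h := y.2
  have h' := y'.2
  split_ifs <;> first | (exfalso; omega) | rfl

/-- A step forward changes the comparison with `y` when it leaves `y`, and when it wraps from the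
last element to 0. The two changes coincide, and cancel, if `y` is the last element. -/
theorem Fin.le_add_add_one_le (y' y : Fin n) :
    ((if y' ≤ y then 1 else 0) + (if y' + 1 ≤ y then 1 else 0) : ZMod 2) =
      (if y' = y then 1 else 0) + if y' = -1 then 1 else 0 := by
  simp only [Fin.eq_neg_one_iff_val]
  simp only [Fin.le_def, Fin.ext_iff, Fin.val_add_one_cyclic]
  have h := y.2
  have h' := y'.2
  split_ifs <;> first | (exfalso; omega) | rfl

theorem Fin.le_add_le_sub_one (y' y : Fin n) :
    ((if y' ≤ y then 1 else 0) + (if y' ≤ y - 1 then 1 else 0) : ZMod 2) =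
      (if y' = y then 1 else 0) + if y = 0 then 1 else 0 := by
  obtain ⟨z, rfl⟩ : ∃ z, y = z + 1 := ⟨y - 1, by simp⟩
  rw [add_sub_cancel_right]
  simp only [Fin.le_def, Fin.ext_iff, Fin.val_add_one_cyclic, Fin.val_zero]
  have h := z.2
  have h' := y'.2
  split_ifs <;> first | (exfalso; omega) | rfl

/-- Summation of differences along a cycle, modulo 2. -/
theorem sum_le_add_sub_one (g : Fin n → ZMod 2) (y : Fin n) :
    ∑ y', (if y' ≤ y then g y' + g (y' - 1) else 0) = g y + g (-1) := by
  have h1 : ∑ y', (if y' ≤ y then g (y' - 1) else 0) = ∑ y', if y' + 1 ≤ y then g y' else 0 := by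
    rw [← Equiv.sum_comp (Equiv.addRight (1 : Fin n))]
    simp
  have h2 : ∀ y', (if y' ≤ y then g y' + g (y' - 1) else 0) =
      (if y' ≤ y then g y' else 0) + if y' ≤ y then g (y' - 1) else 0 := by
    intro y'
    split_ifs <;> simp
  simp_rw [h2]
  rw [sum_add_distrib, h1, ← sum_add_distrib]
  have h3 : ∀ y', ((if y' ≤ y then g y' else 0) + if y' + 1 ≤ y then g y' else 0) =
      (if y' = y then g y' else 0) + if y' = -1 then g y' else 0 := by
    intro y'
    have h := congrArg (· * g y') (Fin.le_add_add_one_le y' y)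
    simpa only [add_mul, ite_mul, one_mul, zero_mul] using h
  simp_rw [h3]
  rw [sum_add_distrib]
  simp

/-- Differences of partial sums along a cycle, modulo 2. -/
theorem sum_le_add_sum_le_sub_one (g : Fin n → ZMod 2) (y : Fin n) :
    (∑ y', if y' ≤ y then g y' else 0) + (∑ y', if y' ≤ y - 1 then g y' else 0) =
      g y + if y = 0 then ∑ y', g y' else 0 := by
  rw [← sum_add_distrib]
  have h3 : ∀ y', ((if y' ≤ y then g y' else 0) + if y' ≤ y - 1 then g y' else 0) =
      (if y' = y then g y' else 0) + if y = 0 then g y' else 0 := by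
    intro y'
    have h := congrArg (· * g y') (Fin.le_add_le_sub_one y' y)
    simpa only [add_mul, ite_mul, one_mul, zero_mul] using h
  simp_rw [h3]
  rw [sum_add_distrib]
  congr 1
  · simp
  · split_ifs <;> simp

end CyclicSums

/-! ### Griffiths' inequality on a finite group. -/

section Correlation

open Finset

/-- The nontrivial additive character of `ZMod 2`. -/
def parityChar (R : Type*) [CommRing R] : AddChar (ZMod 2) R where
  toFun t := if t = 0 then 1 else -1
  map_zero_eq_one' := if_pos rfl
  map_add_eq_mul' s t := by
    have h : ∀ t : ZMod 2, t = 0 ∨ t = 1 := by decide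
    rcases h s with rfl | rfl <;> rcases h t with rfl | rfl <;>
      simp [show (1 : ZMod 2) + 1 = 0 from rfl]

theorem parityChar_apply {R : Type*} [CommRing R] (t : ZMod 2) :
    parityChar R t = if t = 0 then 1 else -1 := rfl

theorem parityChar_sum {R ι : Type*} [CommRing R] (s : Finset ι) (g : ι → ZMod 2) :
    parityChar R (∑ i ∈ s, g i) = ∏ i ∈ s, parityChar R (g i) := by
  classical
  induction s using Finset.induction_on with
  | empty => simp
  | insert a s ha ih => rw [sum_insert ha, prod_insert ha, AddChar.map_add_eq_mul, ih]

theorem parityChar_le_one (t : ZMod 2) : parityChar ℝ t ≤ 1 := by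
  rw [parityChar_apply]
  split_ifs <;> norm_num

/-- Griffiths' comparison: changing the signs of ferromagnetic couplings lowers the partition
function. -/
theorem sum_prod_add_mul_addChar_le {G J : Type*} [AddGroup G] [Fintype G] [Fintype J]
    (ψ : J → AddChar G ℝ) (α β : J → ℝ) (hα : ∀ j, 0 ≤ α j) (hβ : ∀ j, 0 ≤ β j)
    (η : J → ZMod 2) :
    ∑ σ, ∏ j, (α j + β j * (parityChar ℝ (η j) * ψ j σ)) ≤ ∑ σ, ∏ j, (α j + β j * ψ j σ) := by
  classical
  simp_rw [prod_add]
  rw [sum_comm, sum_comm (s := (univ : Finset G))]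
  refine sum_le_sum fun t _ => ?_
  simp_rw [prod_mul_distrib, ← mul_sum]
  rw [← parityChar_sum]
  -- A product of characters is a character, so its sum over the group is the order of the group or
  -- 0. After expansion the sign changes only multiply nonnegative terms by ±1.
  have hψ : 0 ≤ ∑ σ, ∏ j ∈ univ \ t, ψ j σ := by
    have h := AddChar.sum_eq_ite (∏ j ∈ univ \ t, ψ j)
    simp only [AddChar.prod_apply] at h
    rw [h]
    split_ifs <;> positivity
  have h1 : 0 ≤ ∏ j ∈ t, α j := prod_nonneg fun j _ => hα j
  have h2 : 0 ≤ ∏ j ∈ univ \ t, β j := prod_nonneg fun j _ => hβ j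
  refine mul_le_mul_of_nonneg_left (mul_le_mul_of_nonneg_left ?_ h2) h1
  exact mul_le_of_le_one_left hψ (parityChar_le_one _)

end Correlation

/-! ### Even subgraphs of the torus, their homology classes, and Ising spins on the faces. -/

section EvenSubgraphs

open Finset

/-- Sets of horizontal and of vertical edges of the square grid on the torus, as indicator functions
with values in `ZMod 2`. -/
abbrev GridChain (n : ℕ) := (Fin n × Fin n → ZMod 2) × (Fin n × Fin n → ZMod 2)

namespace GridChain

variable {n : ℕ} [NeZero n]

/-- Every site has even degree. -/
def IsEven (p : GridChain n) : Prop :=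
  ∀ x y, p.1 (x, y) + p.1 (x - 1, y) + p.2 (x, y) + p.2 (x, y - 1) = 0

instance (p : GridChain n) : Decidable p.IsEven := by unfold IsEven; infer_instance

/-- Parity of the number of edges crossing the last column line. -/
def windX (p : GridChain n) : ZMod 2 := ∑ y, p.1 (-1, y)

/-- Parity of the number of edges crossing the last row line. -/
def windY (p : GridChain n) : ZMod 2 := ∑ x, p.2 (x, -1)

/-- The set of edges separating faces of different spin `σ`, with couplings changed along a row if
`i = 1` and along a column if `j = 1`. -/
def ofSpin (i j : ZMod 2) (σ : Fin n × Fin n → ZMod 2) : GridChain n :=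
  (fun s => σ s + σ (s.1, s.2 - 1) + if s.2 = 0 then i else 0,
    fun s => σ s + σ (s.1 - 1, s.2) + if s.1 = 0 then j else 0)

theorem sum_shift (g : Fin n → ZMod 2) : ∑ y, g (y - 1) = ∑ y, g y :=
  (Equiv.subRight (1 : Fin n)).sum_comp g

theorem isEven_ofSpin (i j : ZMod 2) (σ : Fin n × Fin n → ZMod 2) : (ofSpin i j σ).IsEven := by
  intro x y
  simp only [ofSpin]
  grind [ZMod.two_add_self]

theorem windX_ofSpin (i j : ZMod 2) (σ : Fin n × Fin n → ZMod 2) : (ofSpin i j σ).windX = i := by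
  simp only [ofSpin, windX, sum_add_distrib]
  rw [sum_shift fun y => σ (-1, y), ZMod.two_add_self]
  simp

theorem windY_ofSpin (i j : ZMod 2) (σ : Fin n × Fin n → ZMod 2) : (ofSpin i j σ).windY = j := by
  simp only [ofSpin, windY, sum_add_distrib]
  rw [sum_shift fun x => σ (x, -1), ZMod.two_add_self]
  simp

/-- Adding the evenness conditions over a column cancels all vertical edges, so the parity crossing
each column line is the same. -/
theorem IsEven.sum_column {p : GridChain n} (hp : p.IsEven) (x : Fin n) :
    ∑ y, p.1 (x, y) = p.windX := by
  have hstep : ∀ x, ∑ y, p.1 (x, y) = ∑ y, p.1 (x - 1, y) := by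
    intro x
    have h : ∑ y, (p.1 (x, y) + p.1 (x - 1, y) + p.2 (x, y) + p.2 (x, y - 1)) = 0 :=
      sum_eq_zero fun y _ => hp x y
    simp only [sum_add_distrib] at h
    rw [sum_shift fun y => p.2 (x, y), add_assoc, ZMod.two_add_self, add_zero] at h
    rw [← CharTwo.sub_eq_add] at h
    exact sub_eq_zero.1 h
  exact Fin.eq_of_eq_sub_one (fun x => ∑ y, p.1 (x, y)) hstep x

theorem IsEven.sum_row {p : GridChain n} (hp : p.IsEven) (y : Fin n) :
    ∑ x, p.2 (x, y) = p.windY := by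
  have hstep : ∀ y, ∑ x, p.2 (x, y) = ∑ x, p.2 (x, y - 1) := by
    intro y
    have h : ∑ x, (p.1 (x, y) + p.1 (x - 1, y) + (p.2 (x, y) + p.2 (x, y - 1))) = 0 :=
      sum_eq_zero fun x _ => by rw [← add_assoc]; exact hp x y
    simp only [sum_add_distrib] at h
    rw [sum_shift fun x => p.1 (x, y), ZMod.two_add_self, zero_add] at h
    rw [← CharTwo.sub_eq_add] at h
    exact sub_eq_zero.1 h
  exact Fin.eq_of_eq_sub_one (fun y => ∑ x, p.2 (x, y)) hstep y

/-- This is the vanishing of a cohomology class with zero periods: once the standard representative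
of the class is subtracted, the spin is found by integrating along a path of faces. -/
theorem IsEven.exists_ofSpin_eq {p : GridChain n} (hp : p.IsEven) :
    ∃ σ, ofSpin p.windX p.windY σ = p := by
  set h' : Fin n × Fin n → ZMod 2 := fun s => p.1 s + if s.2 = 0 then p.windX else 0 with hh'
  set v' : Fin n × Fin n → ZMod 2 := fun s => p.2 s + if s.1 = 0 then p.windY else 0 with hv'
  have hsum : ∀ x, ∑ y, h' (x, y) = 0 := by
    intro x
    simp only [hh', sum_add_distrib]
    rw [hp.sum_column]
    simp [ZMod.two_add_self]
  have vsum : ∑ x, v' (x, -1) = 0 := by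
    simp only [hv', sum_add_distrib]
    rw [hp.sum_row]
    simp [ZMod.two_add_self]
  have heven : ∀ x y, h' (x, y) + h' (x - 1, y) = v' (x, y) + v' (x, y - 1) := by
    intro x y
    have := hp x y
    simp only [hh', hv']
    grind [ZMod.two_add_self]
  -- The path runs along the faces of the last row to column `s.1`, then up that column. `hsum` and
  -- `vsum` ensure that nothing is picked up on closing the cycles.
  set τ : Fin n × Fin n → ZMod 2 := fun s =>
    (∑ x', if x' ≤ s.1 then v' (x', -1) else 0) + ∑ y', if y' ≤ s.2 then h' (s.1, y') else 0 with hτ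
  have τh : ∀ x y, τ (x, y) + τ (x, y - 1) = h' (x, y) := by
    intro x y
    have h := sum_le_add_sum_le_sub_one (fun y => h' (x, y)) y
    rw [hsum, ite_self, add_zero] at h
    simp only [hτ]
    rw [← h]
    grind [ZMod.two_add_self]
  have τv : ∀ x y, τ (x, y) + τ (x - 1, y) = v' (x, y) := by
    intro x y
    have h1 := sum_le_add_sum_le_sub_one (fun x => v' (x, -1)) x
    rw [vsum, ite_self, add_zero] at h1
    have h2 := sum_le_add_sub_one (fun y => v' (x, y)) y
    have h3 : (∑ y', if y' ≤ y then h' (x, y') else 0) +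
        (∑ y', if y' ≤ y then h' (x - 1, y') else 0) = v' (x, y) + v' (x, -1) := by
      rw [← sum_add_distrib, ← h2]
      refine sum_congr rfl fun y' _ => ?_
      split_ifs
      · exact heven x y'
      · rfl
    simp only [hτ]
    grind [ZMod.two_add_self]
  refine ⟨τ, Prod.ext (funext fun s => ?_) (funext fun s => ?_)⟩
  · obtain ⟨x, y⟩ := s
    simp only [ofSpin]
    rw [τh, hh']
    grind [ZMod.two_add_self]
  · obtain ⟨x, y⟩ := s
    simp only [ofSpin]
    rw [τv, hv']
    grind [ZMod.two_add_self]

/-- The weight of a set of edges. -/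
noncomputable def weight (a b : Fin n → Fin n → ℝ) (p : GridChain n) : ℝ :=
  ∏ s, (if p.1 s = 0 then 1 else a s.1 s.2) * if p.2 s = 0 then 1 else b s.1 s.2

/-- The partition function of even subgraphs in a given homology class. -/
noncomputable def partition (a b : Fin n → Fin n → ℝ) (i j : ZMod 2) : ℝ :=
  ∑ p : GridChain n with p.IsEven ∧ p.windX = i ∧ p.windY = j, p.weight a b

/-- `ofSpin i j` is affine with linear part `ofSpin 0 0`, so its nonempty fibres are cosets of one
kernel. The common multiplicity is independent of the class, which makes the partition functions
comparable. -/
theorem card_ofSpin_fiber {i j : ZMod 2} {p : GridChain n} (hp : p.IsEven) (hi : p.windX = i)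
    (hj : p.windY = j) :
    (univ.filter fun σ => ofSpin i j σ = p).card = (univ.filter fun σ : Fin n × Fin n → ZMod 2 =>
      ofSpin 0 0 σ = 0).card := by
  obtain ⟨τ, hτ⟩ := hp.exists_ofSpin_eq
  rw [hi, hj] at hτ
  have key : ∀ σ, ofSpin i j (σ + τ) = ofSpin 0 0 σ + ofSpin i j τ := by
    intro σ
    refine Prod.ext (funext fun s => ?_) (funext fun s => ?_) <;>
    · simp only [ofSpin, Pi.add_apply, Prod.fst_add, Prod.snd_add, ite_self]
      ring
  symm
  refine card_bij (fun σ _ => σ + τ) ?_ (fun σ _ σ' _ h => add_right_cancel h) ?_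
  · intro σ hσ
    rw [mem_filter] at hσ ⊢
    exact ⟨mem_univ _, by rw [key, hσ.2, hτ, zero_add]⟩
  · intro σ hσ
    rw [mem_filter] at hσ
    refine ⟨σ - τ, mem_filter.2 ⟨mem_univ _, ?_⟩, sub_add_cancel _ _⟩
    have h := key (σ - τ)
    rw [sub_add_cancel, hσ.2, hτ] at h
    exact left_eq_add.1 (by rw [add_comm]; exact h)

theorem card_mul_partition (a b : Fin n → Fin n → ℝ) (i j : ZMod 2) :
    ((univ.filter fun σ : Fin n × Fin n → ZMod 2 => ofSpin 0 0 σ = 0).card : ℝ) *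
      partition a b i j = ∑ σ, (ofSpin i j σ).weight a b := by
  rw [partition, mul_sum, ← sum_fiberwise_of_maps_to
    (t := univ.filter fun p : GridChain n => p.IsEven ∧ p.windX = i ∧ p.windY = j)
    (g := fun σ => ofSpin i j σ)]
  · refine sum_congr rfl fun p hp => ?_
    obtain ⟨h1, h2, h3⟩ := (mem_filter.1 hp).2
    rw [← card_ofSpin_fiber h1 h2 h3, ← nsmul_eq_mul]
    refine (sum_eq_card_nsmul fun σ hσ => ?_).symm
    rw [(mem_filter.1 hσ).2]
  · intro σ _
    exact mem_filter.2 ⟨mem_univ _, isEven_ofSpin i j σ, windX_ofSpin i j σ, windY_ofSpin i j σ⟩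

theorem card_ofSpin_zero_pos :
    (0 : ℝ) < (univ.filter fun σ : Fin n × Fin n → ZMod 2 => ofSpin 0 0 σ = 0).card := by
  rw [Nat.cast_pos, card_pos]
  refine ⟨0, mem_filter.2 ⟨mem_univ _, ?_⟩⟩
  refine Prod.ext (funext fun s => ?_) (funext fun s => ?_) <;> simp [ofSpin]

omit [NeZero n] in
theorem weight_pos {a b : Fin n → Fin n → ℝ} (ha : ∀ x y, a x y ∈ Set.Ioo (0 : ℝ) 1)
    (hb : ∀ x y, b x y ∈ Set.Ioo (0 : ℝ) 1) (p : GridChain n) : 0 < p.weight a b := by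
  refine prod_pos fun s _ => mul_pos ?_ ?_
  · split_ifs
    · exact one_pos
    · exact (ha _ _).1
  · split_ifs
    · exact one_pos
    · exact (hb _ _).1

theorem partition_pos {a b : Fin n → Fin n → ℝ} (ha : ∀ x y, a x y ∈ Set.Ioo (0 : ℝ) 1)
    (hb : ∀ x y, b x y ∈ Set.Ioo (0 : ℝ) 1) (i j : ZMod 2) : 0 < partition a b i j :=
  sum_pos (fun p _ => weight_pos ha hb p) ⟨ofSpin i j 0, mem_filter.2
    ⟨mem_univ _, isEven_ofSpin i j 0, windX_ofSpin i j 0, windY_ofSpin i j 0⟩⟩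

/-- The character of the spin configurations given by the product of the spins of two faces. -/
def spinChar (s t : Fin n × Fin n) : AddChar (Fin n × Fin n → ZMod 2) ℝ :=
  (parityChar ℝ).compAddMonoidHom
    (Pi.evalAddMonoidHom (fun _ => ZMod 2) s + Pi.evalAddMonoidHom (fun _ => ZMod 2) t)

omit [NeZero n] in
theorem spinChar_apply (s t : Fin n × Fin n) (σ : Fin n × Fin n → ZMod 2) :
    spinChar s t σ = parityChar ℝ (σ s + σ t) := rfl

/-- For W in (0, 1) both coefficients are positive: the coupling is ferromagnetic. -/
theorem ite_eq_add_mul_parityChar (W : ℝ) (t : ZMod 2) :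
    (if t = 0 then 1 else W) = (1 + W) / 2 + (1 - W) / 2 * parityChar ℝ t := by
  rw [parityChar_apply]
  split_ifs <;> ring

/-- In terms of spins, the class (i, j) only multiplies by signs the couplings across the horizontal
edges of row 0 and the vertical edges of column 0, so Griffiths' comparison applies. -/
theorem partition_le {a b : Fin n → Fin n → ℝ} (ha : ∀ x y, a x y ∈ Set.Ioo (0 : ℝ) 1)
    (hb : ∀ x y, b x y ∈ Set.Ioo (0 : ℝ) 1) (i j : ZMod 2) :
    partition a b i j ≤ partition a b 0 0 := by
  refine le_of_mul_le_mul_left ?_ (card_ofSpin_zero_pos (n := n))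
  rw [card_mul_partition, card_mul_partition]
  have h := sum_prod_add_mul_addChar_le
    (Sum.elim (fun s : Fin n × Fin n => spinChar s (s.1, s.2 - 1))
      fun s : Fin n × Fin n => spinChar s (s.1 - 1, s.2))
    (Sum.elim (fun s => (1 + a s.1 s.2) / 2) fun s => (1 + b s.1 s.2) / 2)
    (Sum.elim (fun s => (1 - a s.1 s.2) / 2) fun s => (1 - b s.1 s.2) / 2)
    (by
      rintro (s | s)
      · have := (ha s.1 s.2).1
        simp only [Sum.elim_inl]
        linarith
      · have := (hb s.1 s.2).1
        simp only [Sum.elim_inr]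
        linarith)
    (by
      rintro (s | s)
      · have := (ha s.1 s.2).2
        simp only [Sum.elim_inl]
        linarith
      · have := (hb s.1 s.2).2
        simp only [Sum.elim_inr]
        linarith)
    (Sum.elim (fun s => if s.2 = 0 then i else 0) fun s => if s.1 = 0 then j else 0)
  simp only [Fintype.prod_sum_type, Sum.elim_inl, Sum.elim_inr] at h
  have e : ∀ i j σ, (ofSpin i j σ).weight a b =
      (∏ s : Fin n × Fin n, ((1 + a s.1 s.2) / 2 + (1 - a s.1 s.2) / 2 *
        (parityChar ℝ (if s.2 = 0 then i else 0) * spinChar s (s.1, s.2 - 1) σ))) *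
      ∏ s : Fin n × Fin n, ((1 + b s.1 s.2) / 2 + (1 - b s.1 s.2) / 2 *
        (parityChar ℝ (if s.1 = 0 then j else 0) * spinChar s (s.1 - 1, s.2) σ)) := by
    intro i j σ
    rw [weight, prod_mul_distrib]
    simp_rw [ite_eq_add_mul_parityChar, ofSpin, AddChar.map_add_eq_mul, spinChar_apply,
      AddChar.map_add_eq_mul]
    congr 1 <;> exact prod_congr rfl fun s _ => by ring
  simp_rw [e]
  simpa using h

end GridChain

end EvenSubgraphs

/-! ### Inversions between grid edges in the lexicographic numbering of the sites. -/

section CrossingSums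

open Finset

/-- Indicator of `a = b` modulo 2. -/
def eqInd {α : Type*} [DecidableEq α] (a b : α) : ZMod 2 := if a = b then 1 else 0

theorem eqInd_comm {α : Type*} [DecidableEq α] (a b : α) : eqInd a b = eqInd b a := by
  simp only [eqInd, eq_comm]

theorem eqInd_self {α : Type*} [DecidableEq α] (a : α) : eqInd a a = 1 := if_pos rfl

theorem eqInd_prod {α β : Type*} [DecidableEq α] [DecidableEq β] (a b : α × β) :
    eqInd a b = eqInd a.1 b.1 * eqInd a.2 b.2 := by
  simp only [eqInd, Prod.ext_iff]
  split_ifs <;> simp_all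

theorem sum_mul_eqInd {α : Type*} [Fintype α] [DecidableEq α] (F : α → ZMod 2) (a : α) :
    ∑ t, F t * eqInd t a = F a := by
  simp [eqInd]

/-- Indicator of `a < b` modulo 2. -/
def ltInd {α : Type*} [LinearOrder α] (a b : α) : ZMod 2 := if a < b then 1 else 0

theorem ltInd_swap {α : Type*} [LinearOrder α] (a b : α) :
    ltInd a b = 1 + ltInd b a + eqInd a b := by
  simp only [ltInd, eqInd]
  rcases lt_trichotomy a b with h | h | h
  · simp [h, h.ne, h.not_gt]
  · subst h
    simp [ZMod.two_add_self]
  · simp [h, h.ne', h.not_gt, ZMod.two_add_self]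

variable {n : ℕ} [NeZero n]

theorem eqInd_add_one (a b : Fin n) : eqInd (a + 1) b = eqInd a (b - 1) := by
  simp only [eqInd, eq_sub_iff_add_eq]

theorem eqInd_add_one_add_one (a b : Fin n) : eqInd (a + 1) (b + 1) = eqInd a b := by
  simp only [eqInd, add_left_inj]

theorem ltInd_add_ltInd_add_one (a b : Fin n) :
    ltInd a b + ltInd (a + 1) b = eqInd (a + 1) b + eqInd a (-1) :=
  Fin.lt_add_add_one_lt a b

/-- Indicator of the lexicographic order of sites. -/
def siteLt (s t : Fin n × Fin n) : ZMod 2 :=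
  ltInd s.1 t.1 + eqInd s.1 t.1 * ltInd s.2 t.2

omit [NeZero n] in
theorem siteLt_self (s : Fin n × Fin n) : siteLt s s = 0 := by
  simp [siteLt, ltInd]

omit [NeZero n] in
theorem siteLt_swap (s t : Fin n × Fin n) : siteLt s t = 1 + siteLt t s + eqInd s t := by
  simp only [siteLt, eqInd_prod]
  rw [ltInd_swap s.1, ltInd_swap s.2, eqInd_comm t.1 s.1]
  have h : eqInd s.1 t.1 + eqInd s.1 t.1 = 0 := ZMod.two_add_self _
  linear_combination h

omit [NeZero n] in
/-- In a sum over ordered pairs, a symmetrized kernel can be replaced by the kernel summed over all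
pairs. -/
theorem sum_siteLt_mul_symm (w : Fin n × Fin n → ZMod 2)
    (P : Fin n × Fin n → Fin n × Fin n → ZMod 2) (hP : ∀ s, P s s = 0) :
    ∑ s, ∑ t, siteLt s t * (w s * w t * (P s t + P t s)) = ∑ s, ∑ t, w s * w t * P s t := by
  have h1 : ∑ s, ∑ t, siteLt s t * (w s * w t * P t s) =
      ∑ s, ∑ t, siteLt t s * (w s * w t * P s t) := by
    rw [sum_comm]
    exact sum_congr rfl fun s _ => sum_congr rfl fun t _ => by ring
  have h2 : ∀ s t, siteLt s t * (w s * w t * (P s t + P t s)) =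
      siteLt s t * (w s * w t * P s t) + siteLt s t * (w s * w t * P t s) := fun s t => by ring
  simp_rw [h2, sum_add_distrib]
  rw [h1]
  simp_rw [← sum_add_distrib]
  refine sum_congr rfl fun s _ => sum_congr rfl fun t _ => ?_
  by_cases hst : s = t
  · subst hst
    simp [hP]
  · rw [siteLt_swap s t, eqInd, if_neg hst]
    have h : siteLt t s + siteLt t s = 0 := ZMod.two_add_self _
    linear_combination h * (w s * w t * P s t)

/-- Neighbour to the right. -/
def siteRight (s : Fin n × Fin n) : Fin n × Fin n := (s.1 + 1, s.2)

/-- Neighbour above. -/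
def siteUp (s : Fin n × Fin n) : Fin n × Fin n := (s.1, s.2 + 1)

/-- Columns are compared first, so moving `t` up can change its order only relative to its own
column: on arriving at `s`, or on wrapping around. -/
theorem siteLt_add_siteLt_siteUp (t s : Fin n × Fin n) :
    siteLt t s + siteLt (siteUp t) s =
      eqInd t.1 s.1 * (eqInd (t.2 + 1) s.2 + eqInd t.2 (-1)) := by
  have h := ltInd_add_ltInd_add_one t.2 s.2
  have h' : ltInd t.1 s.1 + ltInd t.1 s.1 = 0 := ZMod.two_add_self _
  simp only [siteLt, siteUp]
  linear_combination h' + eqInd t.1 s.1 * h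

theorem siteLt_add_siteLt_siteRight (t s : Fin n × Fin n) :
    siteLt t s + siteLt (siteRight t) s =
      eqInd (t.1 + 1) s.1 + eqInd t.1 (-1) +
        (eqInd t.1 s.1 + eqInd (t.1 + 1) s.1) * ltInd t.2 s.2 := by
  have h := ltInd_add_ltInd_add_one t.1 s.1
  simp only [siteLt, siteRight]
  linear_combination h

/-- Sum of the order indicators between the ends of two vertical edges. -/
theorem siteLt_ver_ver (s t : Fin n × Fin n) :
    siteLt t s + siteLt (siteUp t) s + (siteLt t (siteUp s) + siteLt (siteUp t) (siteUp s)) =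
      eqInd t.1 s.1 * eqInd (t.2 + 1) s.2 + eqInd t s := by
  rw [siteLt_add_siteLt_siteUp, siteLt_add_siteLt_siteUp, eqInd_prod]
  simp only [siteUp]
  rw [eqInd_add_one_add_one]
  have h := ZMod.two_add_self (eqInd t.1 s.1 * eqInd t.2 (-1))
  linear_combination h

/-- Sum of the order indicators between the ends of two horizontal edges. -/
theorem siteLt_hor_hor (s t : Fin n × Fin n) :
    siteLt t s + siteLt (siteRight t) s +
      (siteLt t (siteRight s) + siteLt (siteRight t) (siteRight s)) =
      eqInd t.1 s.1 + eqInd (t.1 + 1) s.1 * (1 + ltInd t.2 s.2) +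
        eqInd t.1 (s.1 + 1) * ltInd t.2 s.2 := by
  rw [siteLt_add_siteLt_siteRight, siteLt_add_siteLt_siteRight]
  simp only [siteRight]
  rw [eqInd_add_one_add_one]
  have h := ZMod.two_add_self (eqInd t.1 (-1))
  have h' := ZMod.two_add_self (eqInd t.1 s.1 * ltInd t.2 s.2)
  linear_combination h + h'

/-- Sum of the order indicators between the ends of a horizontal and a vertical edge. -/
theorem siteLt_hor_ver (s t : Fin n × Fin n) :
    siteLt t s + siteLt (siteUp t) s +
      (siteLt t (siteRight s) + siteLt (siteUp t) (siteRight s)) =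
      (eqInd t.1 s.1 + eqInd t.1 (s.1 + 1)) * (eqInd t.2 (s.2 - 1) + eqInd t.2 (-1)) := by
  rw [siteLt_add_siteLt_siteUp, siteLt_add_siteLt_siteUp]
  simp only [siteRight, eqInd_add_one]
  ring

theorem Fin.one_ne_zero_of_even (hn : Even n) : (1 : Fin n) ≠ 0 := by
  have h0 : n ≠ 0 := NeZero.ne n
  have h1 : 1 < n := by
    obtain ⟨m, hm⟩ := hn
    omega
  rw [Ne, Fin.ext_iff]
  have : Fact (1 < n) := ⟨h1⟩
  simp [Nat.mod_eq_of_lt h1]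

/-- Evenness and n ≠ 0 exclude n = 1, where a site would be its own neighbour. -/
theorem eqInd_self_add_one (hn : Even n) (a : Fin n) : eqInd a (a + 1) = 0 :=
  if_neg fun h => Fin.one_ne_zero_of_even hn (left_eq_add.1 h)

namespace GridChain

/-- Off the diagonal the kernel is the symmetrization of "t is just above s". The added indicator is
the comparison of U with D inside the common gadget of two consecutive edges. -/
theorem sum_ver_ver (hn : Even n) (v : Fin n × Fin n → ZMod 2) :
    ∑ s, ∑ t, siteLt s t * (v s * v t * (siteLt t s + siteLt (siteUp t) s +
      (siteLt t (siteUp s) + siteLt (siteUp t) (siteUp s)) + eqInd t (siteUp s))) =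
      ∑ s, v s * v (siteUp s) := by
  have h := sum_siteLt_mul_symm v (fun s t => eqInd t (siteUp s)) fun s => by
    rw [eqInd_prod]
    simp only [siteUp]
    rw [eqInd_self_add_one hn, mul_zero]
  have h2 : ∀ s, ∑ t, v s * v t * eqInd t (siteUp s) = v s * v (siteUp s) := by
    intro s
    exact sum_mul_eqInd (fun t => v s * v t) _
  simp_rw [h2] at h
  rw [← h]
  refine sum_congr rfl fun s _ => sum_congr rfl fun t _ => ?_
  by_cases hst : t = s
  · rw [hst, siteLt_self, zero_mul, zero_mul]
  · rw [siteLt_ver_ver, eqInd, eqInd, eqInd, eqInd, if_neg hst, add_zero, eqInd_prod s]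
    simp only [siteUp, eqInd, eq_comm (a := s.1), eq_comm (a := s.2)]
    ring

/-- The wrap-around terms at the two ends of the horizontal edges both sum to `windX * windY` and
cancel. -/
theorem sum_hor_ver {p : GridChain n} (hp : p.IsEven) :
    ∑ s, ∑ t, p.1 s * p.2 t * (siteLt t s + siteLt (siteUp t) s +
      (siteLt t (siteRight s) + siteLt (siteUp t) (siteRight s))) =
      ∑ s, p.1 s * (p.2 (s.1, s.2 - 1) + p.2 (s.1 + 1, s.2 - 1)) := by
  have h1 : ∀ s : Fin n × Fin n, ∑ t, p.1 s * p.2 t * (siteLt t s + siteLt (siteUp t) s +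
      (siteLt t (siteRight s) + siteLt (siteUp t) (siteRight s))) =
      p.1 s * (p.2 (s.1, s.2 - 1) + p.2 (s.1 + 1, s.2 - 1)) +
        (p.1 s * p.2 (s.1, -1) + p.1 s * p.2 (s.1 + 1, -1)) := by
    intro s
    simp_rw [siteLt_hor_ver]
    have e : ∀ t : Fin n × Fin n, p.1 s * p.2 t * ((eqInd t.1 s.1 + eqInd t.1 (s.1 + 1)) *
        (eqInd t.2 (s.2 - 1) + eqInd t.2 (-1))) =
        p.1 s * p.2 t * eqInd t (s.1, s.2 - 1) + p.1 s * p.2 t * eqInd t (s.1, -1) +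
        (p.1 s * p.2 t * eqInd t (s.1 + 1, s.2 - 1) + p.1 s * p.2 t * eqInd t (s.1 + 1, -1)) := by
      intro t
      simp only [eqInd_prod t]
      ring
    simp_rw [e, sum_add_distrib, sum_mul_eqInd]
    ring
  simp_rw [h1]
  rw [sum_add_distrib, sum_add_distrib (f := fun s : Fin n × Fin n => p.1 s * p.2 (s.1, -1))]
  have h2 : ∑ s : Fin n × Fin n, p.1 s * p.2 (s.1, -1) = p.windX * p.windY := by
    rw [Fintype.sum_prod_type]
    simp_rw [← sum_mul, hp.sum_column, ← mul_sum]
    rfl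
  have h3 : ∑ s : Fin n × Fin n, p.1 s * p.2 (s.1 + 1, -1) = p.windX * p.windY := by
    rw [Fintype.sum_prod_type]
    simp_rw [← sum_mul, hp.sum_column, ← mul_sum]
    congr 1
    exact Equiv.sum_comp (Equiv.addRight (1 : Fin n)) fun x => p.2 (x, -1)
  rw [h2, h3, ZMod.two_add_self, add_zero]

omit [NeZero n] in
theorem sum_const_eq_zero (hn : Even n) (a : ZMod 2) : ∑ _x : Fin n, a = 0 := by
  obtain ⟨m, hm⟩ := hn
  rw [sum_const, card_univ, Fintype.card_fin, hm, add_smul, ZMod.two_add_self]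

/-- This is the source of the quadratic term in the homology class. Pairs in adjacent columns are
transported by evenness to pairs in one column, which cancel the pairs already there. What remains
is a local term and the vertical edges of the last row, which give `windX * windY`. -/
theorem sum_hor_hor (hn : Even n) {p : GridChain n} (hp : p.IsEven) :
    ∑ s, ∑ t, siteLt s t * (p.1 s * p.1 t * (siteLt t s + siteLt (siteRight t) s +
      (siteLt t (siteRight s) + siteLt (siteRight t) (siteRight s)) + eqInd t (siteRight s))) =
      p.windX * p.windY + ∑ s, p.1 s * p.2 (siteRight s) := by
  set P : Fin n × Fin n → Fin n × Fin n → ZMod 2 := fun s t =>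
    eqInd t.1 (s.1 + 1) * (ltInd t.2 s.2 + eqInd t.2 s.2) with hP
  have e : ∀ s t : Fin n × Fin n, siteLt t s + siteLt (siteRight t) s +
      (siteLt t (siteRight s) + siteLt (siteRight t) (siteRight s)) + eqInd t (siteRight s) =
      eqInd t.1 s.1 + (P s t + P t s) := by
    intro s t
    rw [siteLt_hor_hor, eqInd_prod]
    simp only [hP, siteRight]
    rw [ltInd_swap s.2 t.2, eqInd_comm s.1, eqInd_comm s.2 t.2]
    have h := ZMod.two_add_self (eqInd t.2 s.2)
    linear_combination -(eqInd (t.1 + 1) s.1 * h)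
  have h := sum_siteLt_mul_symm p.1 P fun s => by
    simp only [hP]
    rw [eqInd_self_add_one hn, zero_mul]
  simp_rw [e, mul_add (p.1 _ * p.1 _) (eqInd _ _), mul_add (siteLt _ _), sum_add_distrib]
  rw [h]
  have h1 : ∑ s, ∑ t, siteLt s t * (p.1 s * p.1 t * eqInd t.1 s.1) =
      ∑ x, ∑ y, p.1 (x, y) * ∑ y', p.1 (x, y') * ltInd y y' := by
    rw [Fintype.sum_prod_type]
    refine sum_congr rfl fun x _ => sum_congr rfl fun y _ => ?_
    rw [Fintype.sum_prod_type, sum_comm, mul_sum]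
    refine sum_congr rfl fun y' _ => ?_
    have e1 : ∀ x', siteLt (x, y) (x', y') * (p.1 (x, y) * p.1 (x', y') * eqInd x' x) =
        siteLt (x, y) (x', y') * (p.1 (x, y) * p.1 (x', y')) * eqInd x' x := fun x' => by ring
    simp only [e1]
    rw [sum_mul_eqInd]
    simp only [siteLt, eqInd_self]
    simp only [ltInd, lt_irrefl, if_false]
    ring
  have h2 : ∑ s, ∑ t, p.1 s * p.1 t * P s t =
      ∑ x, ∑ y, p.1 (x, y) * ∑ y', p.1 (x + 1, y') * (ltInd y' y + eqInd y' y) := by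
    rw [Fintype.sum_prod_type]
    refine sum_congr rfl fun x _ => sum_congr rfl fun y _ => ?_
    rw [Fintype.sum_prod_type, sum_comm, mul_sum]
    refine sum_congr rfl fun y' _ => ?_
    simp only [hP]
    have e1 : ∀ x', p.1 (x, y) * p.1 (x', y') * (eqInd x' (x + 1) * (ltInd y' y + eqInd y' y)) =
        p.1 (x, y) * p.1 (x', y') * (ltInd y' y + eqInd y' y) * eqInd x' (x + 1) :=
      fun x' => by ring
    simp only [e1]
    rw [sum_mul_eqInd]
    ring
  -- Evenness in column x + 1 expresses the difference of the two horizontal sums by vertical edges,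
  -- and that sum telescopes.
  have h3 : ∀ x y, ∑ y', p.1 (x + 1, y') * (ltInd y' y + eqInd y' y) =
      (∑ y', p.1 (x, y') * (ltInd y' y + eqInd y' y)) + (p.2 (x + 1, y) + p.2 (x + 1, -1)) := by
    intro x y
    rw [← sum_le_add_sub_one (fun y => p.2 (x + 1, y)) y, ← sum_add_distrib]
    refine sum_congr rfl fun y' _ => ?_
    have hle : ltInd y' y + eqInd y' y = if y' ≤ y then 1 else 0 := by
      simp only [ltInd, eqInd]
      rcases lt_trichotomy y' y with h | h | h
      · simp [h, h.ne, h.le]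
      · simp [h]
      · simp [h.ne', h.not_gt, h.not_ge]
    have he := hp (x + 1) y'
    rw [add_sub_cancel_right] at he
    rw [hle]
    split_ifs
    · rw [mul_one, mul_one]
      grind [ZMod.two_add_self]
    · simp
  -- The diagonal contributes `windX` for each column, hence 0 over the even number of columns.
  have h4 : ∀ x, ∑ y, p.1 (x, y) * ∑ y', p.1 (x, y') * (ltInd y' y + eqInd y' y) =
      (∑ y, p.1 (x, y) * ∑ y', p.1 (x, y') * ltInd y y') + p.windX := by
    intro x
    have hsq : ∀ a : ZMod 2, a * a = a := by decide
    simp_rw [mul_add, sum_add_distrib, sum_mul_eqInd]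
    simp_rw [mul_add, sum_add_distrib, hsq, hp.sum_column, mul_sum]
    rw [sum_comm]
    congr 1
    exact sum_congr rfl fun _ _ => sum_congr rfl fun _ _ => by ring
  rw [h1, h2]
  have h3' : ∀ x y, p.1 (x, y) * ∑ y', p.1 (x + 1, y') * (ltInd y' y + eqInd y' y) =
      p.1 (x, y) * (∑ y', p.1 (x, y') * (ltInd y' y + eqInd y' y)) +
        (p.1 (x, y) * p.2 (x + 1, y) + p.1 (x, y) * p.2 (x + 1, -1)) := by
    intro x y
    rw [h3, mul_add, mul_add]
  simp_rw [h3', sum_add_distrib, h4, sum_add_distrib]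
  rw [sum_const_eq_zero hn]
  have h5 : ∑ x, ∑ y, p.1 (x, y) * p.2 (x + 1, -1) = p.windX * p.windY := by
    simp_rw [← sum_mul, hp.sum_column, ← mul_sum]
    congr 1
    exact Equiv.sum_comp (Equiv.addRight (1 : Fin n)) fun x => p.2 (x, -1)
  have h6 : ∑ x, ∑ y, p.1 (x, y) * p.2 (x + 1, y) = ∑ s, p.1 s * p.2 (siteRight s) := by
    rw [Fintype.sum_prod_type]
    rfl
  rw [h5, h6]
  have h7 := ZMod.two_add_self (∑ x, ∑ y, p.1 (x, y) * ∑ y', p.1 (x, y') * ltInd y y')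
  linear_combination h7

theorem IsEven.sum_hor (hn : Even n) {p : GridChain n} (hp : p.IsEven) : ∑ s, p.1 s = 0 := by
  rw [Fintype.sum_prod_type]
  simp_rw [hp.sum_column]
  exact sum_const_eq_zero hn _

theorem IsEven.sum_ver (hn : Even n) {p : GridChain n} (hp : p.IsEven) : ∑ s, p.2 s = 0 := by
  rw [Fintype.sum_prod_type_right]
  simp_rw [hp.sum_row]
  exact sum_const_eq_zero hn _

theorem sum_comp_siteRight {M : Type*} [AddCommMonoid M] (F : Fin n × Fin n → M) :
    ∑ s, F (siteRight s) = ∑ s, F s :=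
  Equiv.sum_comp ((Equiv.addRight (1 : Fin n)).prodCongr (Equiv.refl (Fin n))) F

theorem sum_comp_siteUp {M : Type*} [AddCommMonoid M] (F : Fin n × Fin n → M) :
    ∑ s, F (siteUp s) = ∑ s, F s :=
  Equiv.sum_comp ((Equiv.refl (Fin n)).prodCongr (Equiv.addRight (1 : Fin n))) F

theorem sum_comp_left {M : Type*} [AddCommMonoid M] (F : Fin n × Fin n → M) :
    ∑ s : Fin n × Fin n, F (s.1 - 1, s.2) = ∑ s, F s := by
  rw [← sum_comp_siteRight]
  simp [siteRight]

theorem sum_comp_down {M : Type*} [AddCommMonoid M] (F : Fin n × Fin n → M) :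
    ∑ s : Fin n × Fin n, F (s.1, s.2 - 1) = ∑ s, F s := by
  rw [← sum_comp_siteUp]
  simp [siteUp]

/-- The number of edges is half the sum of the degrees. -/
theorem IsEven.sum_half_degree (hn : Even n) {p : GridChain n} (hp : p.IsEven) :
    ∑ s, (p.1 s * p.2 s + p.1 s * p.1 (s.1 - 1, s.2) + p.1 (s.1 - 1, s.2) * p.2 s) = 0 := by
  -- `k` is half the degree of the site. The total of the `k` is the number of edges, which is even
  -- since n is.
  have hdeg : ∀ r l u d : ZMod 2, r + l + u + d = 0 →
      ∃ k : ℕ, r.val + l.val + u.val + d.val = 2 * k ∧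
        r * u + r * l + l * u = (k : ZMod 2) + l + r + u := by
    intro r l u d h
    refine ⟨(r.val + l.val + u.val + d.val) / 2, ?_, ?_⟩
    · revert r l u d
      decide
    · revert r l u d
      decide
  choose k hk1 hk2 using fun s : Fin n × Fin n => hdeg _ _ _ _ (hp s.1 s.2)
  have h1 : ∑ s, k s = ∑ s, (p.1 s).val + ∑ s, (p.2 s).val := by
    have h : ∑ s : Fin n × Fin n, ((p.1 s).val + (p.1 (s.1 - 1, s.2)).val + (p.2 s).val +
        (p.2 (s.1, s.2 - 1)).val) = ∑ s, 2 * k s := sum_congr rfl fun s _ => hk1 s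
    simp only [sum_add_distrib, ← mul_sum] at h
    rw [sum_comp_left fun s => (p.1 s).val, sum_comp_down fun s => (p.2 s).val] at h
    omega
  have h2 : ∑ s, (k s : ZMod 2) = 0 := by
    have h := congrArg (Nat.cast : ℕ → ZMod 2) h1
    push_cast at h
    simp only [ZMod.natCast_val, ZMod.cast_id', id] at h
    rw [h, hp.sum_hor hn, hp.sum_ver hn, add_zero]
  have h3 : ∀ s : Fin n × Fin n,
      p.1 s * p.2 s + p.1 s * p.1 (s.1 - 1, s.2) + p.1 (s.1 - 1, s.2) * p.2 s =
      (k s : ZMod 2) + p.1 (s.1 - 1, s.2) + p.1 s + p.2 s := fun s => hk2 s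
  simp_rw [h3, sum_add_distrib]
  rw [h2, sum_comp_left p.1, hp.sum_hor hn, hp.sum_ver hn]
  simp

end GridChain

end CrossingSums

/-! ### Perfect matchings of the Fisher graph correspond to even subgraphs of the grid. -/

section Matchings

open Finset

theorem FisherKind.sum_eq {M : Type*} [AddCommMonoid M] (F : FisherKind → M) :
    ∑ k, F k = F .hor + (F .ver + (F .mid + (F .ur + (F .rp + (F .pu + (F .dl + (F .lq + F .qd))))))) := by
  have h : (univ : Finset FisherKind) = {.hor, .ver, .mid, .ur, .rp, .pu, .dl, .lq, .qd} := rfl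
  rw [h]
  repeat rw [sum_insert (by decide)]
  rw [sum_singleton]

variable {n : ℕ} [NeZero n]

/-- The site of the second end of an edge of a given kind. -/
def FisherKind.shift : FisherKind → Equiv.Perm (Fin n × Fin n)
  | .hor => ⟨siteRight, fun s => (s.1 - 1, s.2), fun s => by simp [siteRight],
      fun s => by simp [siteRight]⟩
  | .ver => ⟨siteUp, fun s => (s.1, s.2 - 1), fun s => by simp [siteUp], fun s => by simp [siteUp]⟩
  | _ => Equiv.refl _

omit [NeZero n] in
theorem FisherEdge.sum_eq {M : Type*} [AddCommMonoid M] (F : FisherEdge n → M) :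
    ∑ e, F e = ∑ k, ∑ s : Fin n × Fin n, F (s.1, s.2, k) := by
  rw [sum_comm, Fintype.sum_prod_type, Fintype.sum_prod_type]
  refine sum_congr rfl fun x _ => ?_
  rw [Fintype.sum_prod_type]

omit [NeZero n] in
theorem FisherEdge.fst_mk (s : Fin n × Fin n) (k : FisherKind) :
    FisherEdge.fst (s.1, s.2, k) = (s.1, s.2, k.fst) := rfl

theorem FisherEdge.snd_mk (s : Fin n × Fin n) (k : FisherKind) :
    FisherEdge.snd (s.1, s.2, k) = ((k.shift s).1, (k.shift s).2, k.snd) := by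
  cases k <;> rfl

theorem FisherKind.fst_ne_snd (k : FisherKind) : k.fst ≠ k.snd := by
  cases k <;> decide

theorem FisherEdge.fst_ne_snd (e : FisherEdge n) : e.fst ≠ e.snd := by
  obtain ⟨x, y, k⟩ := e
  rw [FisherEdge.fst_mk (x, y), FisherEdge.snd_mk (x, y)]
  exact fun h => k.fst_ne_snd (congrArg (fun v => v.2.2) h)

/-- Number of ends of an edge at a vertex. -/
def FisherEdge.incidence (e : FisherEdge n) (w : FisherVertex n) : ℕ :=
  (if e.fst = w then 1 else 0) + if e.snd = w then 1 else 0

/-- Number of edges of a set at a vertex. -/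
def coverNumber (M : Finset (FisherEdge n)) (w : FisherVertex n) : ℕ :=
  ∑ e ∈ M, e.incidence w

/-- Every vertex lies on exactly one edge. -/
def IsPerfect (M : Finset (FisherEdge n)) : Prop := ∀ w, coverNumber M w = 1

theorem FisherEdge.incidence_le_one (e : FisherEdge n) (w : FisherVertex n) :
    e.incidence w ≤ 1 := by
  have h := e.fst_ne_snd
  unfold FisherEdge.incidence
  split_ifs with h1 h2 <;> first | exact absurd (h1.trans h2.symm) h | omega

theorem sum_coverNumber (M : Finset (FisherEdge n)) : ∑ w, coverNumber M w = 2 * M.card := by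
  simp only [coverNumber]
  rw [sum_comm, sum_congr rfl fun e _ => show ∑ w, e.incidence w = 2 by
    simp [FisherEdge.incidence, sum_add_distrib]]
  rw [sum_const, smul_eq_mul, mul_comm]

omit [NeZero n] in
theorem card_fisherVertex : Fintype.card (FisherVertex n) = 2 * (3 * n * n) := by
  rw [Fintype.card_congr (fisherEnum n), Fintype.card_fin]

theorem IsPerfect.card {M : Finset (FisherEdge n)} (hM : IsPerfect M) :
    M.card = 3 * n * n := by
  have h := sum_coverNumber M
  rw [sum_congr rfl fun w _ => hM w, sum_const, card_univ, card_fisherVertex] at h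
  simp only [smul_eq_mul] at h
  omega

theorem IsPerfect.disjoint {M : Finset (FisherEdge n)} (hM : IsPerfect M) {e e' : FisherEdge n}
    (he : e ∈ M) (he' : e' ∈ M) (hne : e ≠ e') (w : FisherVertex n) :
    e.incidence w = 0 ∨ e'.incidence w = 0 := by
  by_contra! h
  have h1 : ∑ a ∈ {e, e'}, FisherEdge.incidence a w ≤ coverNumber M w :=
    sum_le_sum_of_subset (by
      intro a ha
      rcases mem_insert.1 ha with rfl | ha
      · exact he
      · rw [mem_singleton.1 ha]
        exact he')
  rw [hM w, sum_pair hne] at h1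
  omega

/-- A set of half as many edges as vertices whose edges are pairwise disjoint is perfect. -/
theorem isPerfect_of_card {M : Finset (FisherEdge n)} (hcard : M.card = 3 * n * n)
    (hdis : ∀ e ∈ M, ∀ e' ∈ M, e ≠ e' → ∀ w, e.incidence w = 0 ∨ e'.incidence w = 0) :
    IsPerfect M := by
  have hle : ∀ w, coverNumber M w ≤ 1 := by
    intro w
    by_cases h : ∃ e ∈ M, e.incidence w ≠ 0
    · obtain ⟨e, he, hew⟩ := h
      rw [coverNumber, sum_eq_single_of_mem e he fun e' he' hne =>
        (hdis e' he' e he hne w).resolve_right hew]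
      exact e.incidence_le_one w
    · push Not at h
      rw [coverNumber, sum_eq_zero h]
      exact zero_le_one
  have hsum : ∑ w, coverNumber M w = ∑ _w : FisherVertex n, 1 := by
    rw [sum_coverNumber, hcard, sum_const, card_univ, card_fisherVertex, smul_eq_mul, mul_one]
  intro w
  exact (sum_eq_sum_iff_of_le fun w _ => hle w).1 hsum w (mem_univ w)

/-- Indicator of an edge. -/
def edgeBit (M : Finset (FisherEdge n)) (k : FisherKind) (s : Fin n × Fin n) : ZMod 2 :=
  if (s.1, s.2, k) ∈ M then 1 else 0

omit [NeZero n] in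
theorem edgeBit_eq_one_iff {M : Finset (FisherEdge n)} {k : FisherKind} {s : Fin n × Fin n} :
    edgeBit M k s = 1 ↔ (s.1, s.2, k) ∈ M := by
  simp [edgeBit]

theorem coverNumber_eq_sum (M : Finset (FisherEdge n)) (s : Fin n × Fin n) (c : FisherCorner) :
    coverNumber M (s.1, s.2, c) = ∑ k : FisherKind, ((if k.fst = c then (edgeBit M k s).val else 0) +
      if k.snd = c then (edgeBit M k (k.shift.symm s)).val else 0) := by
  have h1 : coverNumber M (s.1, s.2, c) =
      ∑ e : FisherEdge n, if e ∈ M then e.incidence (s.1, s.2, c) else 0 := by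
    rw [coverNumber, ← sum_filter, filter_mem_eq_inter, univ_inter]
  rw [h1, FisherEdge.sum_eq]
  refine sum_congr rfl fun k _ => ?_
  have h2 : ∀ t : Fin n × Fin n, (if (t.1, t.2, k) ∈ M then
      FisherEdge.incidence (t.1, t.2, k) (s.1, s.2, c) else 0) =
      (if t = s then if k.fst = c then (edgeBit M k t).val else 0 else 0) +
      (if k.shift t = s then if k.snd = c then (edgeBit M k t).val else 0 else 0) := by
    intro t
    have e1 : (FisherEdge.fst (t.1, t.2, k) = (s.1, s.2, c)) ↔ t = s ∧ k.fst = c := by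
      rw [FisherEdge.fst_mk]
      simp only [Prod.ext_iff, and_assoc]
    have e2 : (FisherEdge.snd (t.1, t.2, k) = (s.1, s.2, c)) ↔ k.shift t = s ∧ k.snd = c := by
      rw [FisherEdge.snd_mk]
      simp only [Prod.ext_iff, and_assoc]
    simp only [FisherEdge.incidence, e1, e2, edgeBit, ite_and]
    by_cases h : (t.1, t.2, k) ∈ M <;> simp [h, ZMod.val_one]
  simp_rw [h2, sum_add_distrib, ← Equiv.eq_symm_apply]
  simp

/-- The edges of a gadget in the perfect matching that contains a given even set of edges of the
grid; the arguments tell whether the edges to the right, left, top and bottom are present. -/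
def gadgetMatching (r l u d : ZMod 2) : FisherKind → ZMod 2
  | .hor => r
  | .ver => u
  | .mid => 1 + r + u
  | .ur => (1 + r) * (1 + u)
  | .rp => (1 + r) * u
  | .pu => r * (1 + u)
  | .dl => (1 + l) * (1 + d)
  | .lq => (1 + l) * d
  | .qd => l * (1 + d)

namespace GridChain

/-- The perfect matching corresponding to an even subgraph, edge by edge. -/
def occ (p : GridChain n) (k : FisherKind) (s : Fin n × Fin n) : ZMod 2 :=
  gadgetMatching (p.1 s) (p.1 (s.1 - 1, s.2)) (p.2 s) (p.2 (s.1, s.2 - 1)) k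

/-- The perfect matching corresponding to an even subgraph. -/
def matching (p : GridChain n) : Finset (FisherEdge n) :=
  univ.filter fun e => p.occ e.2.2 (e.1, e.2.1) = 1

theorem edgeBit_matching (p : GridChain n) (k : FisherKind) (s : Fin n × Fin n) :
    edgeBit p.matching k s = p.occ k s := by
  have h : ∀ t : ZMod 2, (if t = 1 then 1 else 0) = t := by decide
  simp only [edgeBit, matching, mem_filter, mem_univ, true_and]
  exact h _

theorem matching_injective : Function.Injective (matching : GridChain n → _) := by
  intro p q h
  refine Prod.ext (funext fun s => ?_) (funext fun s => ?_)
  · have h1 := p.edgeBit_matching .hor s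
    rw [h, q.edgeBit_matching] at h1
    exact h1.symm
  · have h1 := p.edgeBit_matching .ver s
    rw [h, q.edgeBit_matching] at h1
    exact h1.symm

end GridChain

theorem isPerfect_iff (M : Finset (FisherEdge n)) :
    IsPerfect M ↔ ∀ s : Fin n × Fin n,
      ((edgeBit M .hor s).val + (edgeBit M .ur s).val + (edgeBit M .rp s).val = 1 ∧
      (edgeBit M .hor (s.1 - 1, s.2)).val + (edgeBit M .dl s).val + (edgeBit M .lq s).val = 1 ∧
      (edgeBit M .ver s).val + (edgeBit M .ur s).val + (edgeBit M .pu s).val = 1) ∧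
      ((edgeBit M .ver (s.1, s.2 - 1)).val + (edgeBit M .dl s).val + (edgeBit M .qd s).val = 1 ∧
      (edgeBit M .mid s).val + (edgeBit M .rp s).val + (edgeBit M .pu s).val = 1 ∧
      (edgeBit M .mid s).val + (edgeBit M .lq s).val + (edgeBit M .qd s).val = 1) := by
  have hcases : IsPerfect M ↔ ∀ s : Fin n × Fin n, (coverNumber M (s.1, s.2, .R) = 1 ∧
      coverNumber M (s.1, s.2, .L) = 1 ∧ coverNumber M (s.1, s.2, .U) = 1) ∧
      (coverNumber M (s.1, s.2, .D) = 1 ∧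
      coverNumber M (s.1, s.2, .p) = 1 ∧ coverNumber M (s.1, s.2, .q) = 1) := by
    constructor
    · exact fun h s => ⟨⟨h _, h _, h _⟩, h _, h _, h _⟩
    · rintro h ⟨x, y, c⟩
      obtain ⟨⟨h1, h2, h3⟩, h4, h5, h6⟩ := h (x, y)
      cases c <;> assumption
  rw [hcases]
  refine forall_congr' fun s => ?_
  simp only [coverNumber_eq_sum, FisherKind.sum_eq, FisherKind.fst, FisherKind.snd,
    FisherKind.shift, Equiv.refl_symm, Equiv.refl_apply, Equiv.symm_mk, Equiv.coe_fn_mk,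
    reduceCtorEq, if_true, if_false, add_zero, zero_add]
  refine and_congr (and_congr ?_ (and_congr ?_ ?_)) (and_congr ?_ (and_congr ?_ ?_)) <;>
  · constructor <;> intro h <;> omega

theorem gadgetMatching_cover : ∀ r l u d : ZMod 2, r + l + u + d = 0 →
    (r.val + (gadgetMatching r l u d .ur).val + (gadgetMatching r l u d .rp).val = 1 ∧
      l.val + (gadgetMatching r l u d .dl).val + (gadgetMatching r l u d .lq).val = 1 ∧
      u.val + (gadgetMatching r l u d .ur).val + (gadgetMatching r l u d .pu).val = 1) ∧
      (d.val + (gadgetMatching r l u d .dl).val + (gadgetMatching r l u d .qd).val = 1 ∧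
      (gadgetMatching r l u d .mid).val + (gadgetMatching r l u d .rp).val +
        (gadgetMatching r l u d .pu).val = 1 ∧
      (gadgetMatching r l u d .mid).val + (gadgetMatching r l u d .lq).val +
        (gadgetMatching r l u d .qd).val = 1) := by
  decide

set_option synthInstance.maxSize 2000 in
set_option synthInstance.maxHeartbeats 400000 in
/-- The edges inside a triangle and the middle edge are determined by the edges outside. -/
theorem triangle_matching : ∀ r u ur rp pu mid : ZMod 2, r.val + ur.val + rp.val = 1 →
    u.val + ur.val + pu.val = 1 → mid.val + rp.val + pu.val = 1 →
    mid = 1 + r + u ∧ ur = (1 + r) * (1 + u) ∧ rp = (1 + r) * u ∧ pu = r * (1 + u) := by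
  decide

theorem GridChain.IsEven.isPerfect_matching {p : GridChain n} (hp : p.IsEven) :
    IsPerfect p.matching := by
  rw [isPerfect_iff]
  intro s
  simp only [GridChain.edgeBit_matching]
  exact gadgetMatching_cover _ _ _ _ (hp s.1 s.2)

/-- Each triangle with its outer edges determines the middle edge: 1 + r + u from the upper one, 1 +
l + d from the lower one. Equality of the two is evenness at the site. -/
theorem IsPerfect.exists_matching {M : Finset (FisherEdge n)} (hM : IsPerfect M) :
    ∃ p : GridChain n, p.IsEven ∧ p.matching = M := by
  rw [isPerfect_iff] at hM
  have hup := fun s => triangle_matching _ _ _ _ _ _ (hM s).1.1 (hM s).1.2.2 (hM s).2.2.1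
  have hlow := fun s => triangle_matching _ _ _ _ _ _ (hM s).1.2.1 (hM s).2.1 (hM s).2.2.2
  refine ⟨(edgeBit M .hor, edgeBit M .ver), fun x y => ?_, ?_⟩
  · have h := (hup (x, y)).1.symm.trans (hlow (x, y)).1
    grind [ZMod.two_add_self]
  · ext ⟨x, y, k⟩
    rw [← edgeBit_eq_one_iff (s := (x, y)), ← edgeBit_eq_one_iff (s := (x, y)),
      GridChain.edgeBit_matching]
    obtain ⟨h1, h2, h3, h4⟩ := hup (x, y)
    obtain ⟨_, h5, h6, h7⟩ := hlow (x, y)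
    refine Eq.congr_left ?_
    cases k
    · rfl
    · rfl
    · exact h1.symm
    · exact h2.symm
    · exact h3.symm
    · exact h4.symm
    · exact h5.symm
    · exact h6.symm
    · exact h7.symm

end Matchings

/-! ### The sign of a matching in terms of its homology class. -/

section MatchingSign

open Finset

/-- Position of a corner modulo 2 comparisons: `1` if `c` comes before `c'`. -/
def cornerLt (c c' : FisherCorner) : ZMod 2 := ltInd (fisherCornerEquiv c) (fisherCornerEquiv c')

/-- An order of the kinds of edges. -/
def FisherKind.rank : FisherKind → ℕ
  | .hor => 0
  | .ver => 1
  | .mid => 2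
  | .ur => 3
  | .rp => 4
  | .pu => 5
  | .dl => 6
  | .lq => 7
  | .qd => 8

theorem FisherKind.rank_injective : Function.Injective FisherKind.rank := by
  intro k k' h
  revert k k'
  decide

variable {n : ℕ} [NeZero n]

/-- An order of the edges: by kind, then lexicographically by site. -/
def edgeLt (e e' : FisherEdge n) : Prop :=
  e.2.2.rank < e'.2.2.rank ∨
    e.2.2 = e'.2.2 ∧ (e.1 < e'.1 ∨ e.1 = e'.1 ∧ e.2.1 < e'.2.1)

instance : DecidableRel (edgeLt (n := n)) := fun _ _ => by unfold edgeLt; infer_instance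

omit [NeZero n] in
theorem edgeLt_asymm (e e' : FisherEdge n) (h : edgeLt e e') : ¬ edgeLt e' e := by
  unfold edgeLt at *
  rintro (h' | ⟨h1', h2' | h2'⟩) <;> rcases h with h | ⟨h1, h2 | h2⟩ <;>
    first | omega | (have h3 := congrArg FisherKind.rank h1; omega) |
      (have h3 := congrArg FisherKind.rank h1'; omega)

omit [NeZero n] in
theorem edgeLt_total (e e' : FisherEdge n) (h : e ≠ e') : edgeLt e e' ∨ edgeLt e' e := by
  obtain ⟨x, y, k⟩ := e
  obtain ⟨x', y', k'⟩ := e'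
  simp only [edgeLt]
  rcases lt_trichotomy k.rank k'.rank with h1 | h1 | h1
  · exact Or.inl (Or.inl h1)
  · have h2 := FisherKind.rank_injective h1
    subst h2
    rcases lt_trichotomy x x' with h3 | h3 | h3
    · exact Or.inl (Or.inr ⟨rfl, Or.inl h3⟩)
    · subst h3
      rcases lt_trichotomy y y' with h4 | h4 | h4
      · exact Or.inl (Or.inr ⟨rfl, Or.inr ⟨rfl, h4⟩⟩)
      · exact absurd (by rw [h4]) h
      · exact Or.inr (Or.inr ⟨rfl, Or.inr ⟨rfl, h4⟩⟩)
    · exact Or.inr (Or.inr ⟨rfl, Or.inl h3⟩)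
  · exact Or.inr (Or.inl h1)

omit [NeZero n] in
theorem edgeLt_mk (s t : Fin n × Fin n) (k k' : FisherKind) :
    (if edgeLt (s.1, s.2, k) (t.1, t.2, k') then 1 else 0 : ZMod 2) =
      ltInd k.rank k'.rank + eqInd k k' * siteLt s t := by
  simp only [edgeLt, ltInd, eqInd, siteLt]
  by_cases h1 : k.rank < k'.rank
  · have h2 : k ≠ k' := fun h => by rw [h] at h1; exact lt_irrefl _ h1
    simp [h1, h2]
  · by_cases h2 : k = k'
    · rcases lt_trichotomy s.1 t.1 with h3 | h3 | h3
      · simp [h2, h3, h3.ne]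
      · simp [h2, h3]
      · simp [h2, h3.ne', h3.not_gt]
    · simp [h1, h2]

omit [NeZero n] in
theorem fisherEnum_lt_iff (s t : Fin n × Fin n) (c c' : FisherCorner) :
    fisherEnum n (s.1, s.2, c) < fisherEnum n (t.1, t.2, c') ↔
      s.1 < t.1 ∨ s.1 = t.1 ∧ (s.2 < t.2 ∨
        s.2 = t.2 ∧ fisherCornerEquiv c < fisherCornerEquiv c') := by
  have hval : ∀ (s : Fin n × Fin n) (c : FisherCorner), (fisherEnum n (s.1, s.2, c)).val =
      (fisherCornerEquiv c).val + 6 * s.2.val + n * 6 * s.1.val := fun s c => rfl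
  obtain ⟨x, y⟩ := s
  obtain ⟨x', y'⟩ := t
  rw [Fin.lt_def, hval, hval]
  simp only [Fin.lt_def, Fin.ext_iff]
  have h1 := (fisherCornerEquiv c).2
  have h2 := (fisherCornerEquiv c').2
  have h3 := y.2
  have h4 := y'.2
  rcases lt_trichotomy x.val x'.val with h | h | h
  · have h5 : n * 6 * (x.val + 1) ≤ n * 6 * x'.val := Nat.mul_le_mul_left _ h
    rw [mul_add] at h5
    omega
  · rw [h]
    omega
  · have h5 : n * 6 * (x'.val + 1) ≤ n * 6 * x.val := Nat.mul_le_mul_left _ h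
    rw [mul_add] at h5
    omega

/-- Indicator that the first vertex comes after the second. -/
def inversion (u v : FisherVertex n) : ZMod 2 :=
  if fisherEnum n v < fisherEnum n u then 1 else 0

omit [NeZero n] in
theorem inversion_mk (s t : Fin n × Fin n) (c c' : FisherCorner) :
    inversion (s.1, s.2, c) (t.1, t.2, c') = siteLt t s + eqInd t s * cornerLt c' c := by
  rw [eqInd_prod]
  simp only [inversion, fisherEnum_lt_iff, siteLt, cornerLt, ltInd, eqInd]
  rcases lt_trichotomy t.1 s.1 with h | h | h
  · simp [h, h.ne]
  · rcases lt_trichotomy t.2 s.2 with h' | h' | h'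
    · simp [h, h', h'.ne]
    · simp [h, h']
    · simp [h, h'.ne', h'.not_gt]
  · simp [h.ne', h.not_gt]

omit [NeZero n] in
theorem orderSign_fisherEnum {u v : FisherVertex n} (h : u ≠ v) :
    orderSign (fisherEnum n u) (fisherEnum n v) = parityChar ℂ (inversion u v) := by
  have h' : fisherEnum n u ≠ fisherEnum n v := fun e => h ((fisherEnum n).injective e)
  rw [parityChar_apply, orderSign, inversion]
  rcases lt_or_gt_of_ne h' with h1 | h1
  · simp [h1, h1.not_gt]
  · simp [h1, h1.not_gt]

/-- Number of inversions between the ends of two edges modulo 2. -/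
def crossing (e e' : FisherEdge n) : ZMod 2 :=
  inversion e.fst e'.fst + inversion e.fst e'.snd + (inversion e.snd e'.fst + inversion e.snd e'.snd)

/-- The sign exponent of a set of edges. -/
def signExponent (M : Finset (FisherEdge n)) : ZMod 2 :=
  ∑ e ∈ M, inversion e.fst e.snd + ∑ e ∈ M, ∑ e' ∈ M, if edgeLt e e' then crossing e e' else 0

/-- The sign of a set of edges in the Pfaffian. -/
noncomputable def matchingSign (M : Finset (FisherEdge n)) : ℂ :=
  pairingSign edgeLt (fun e => fisherEnum n (FisherEdge.fst e))
    (fun e => fisherEnum n (FisherEdge.snd e)) M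

theorem FisherEdge.incidence_fst_ne_zero (e : FisherEdge n) : e.incidence e.fst ≠ 0 := by
  simp [FisherEdge.incidence]

theorem FisherEdge.incidence_snd_ne_zero (e : FisherEdge n) : e.incidence e.snd ≠ 0 := by
  simp [FisherEdge.incidence]

theorem IsPerfect.matchingSign_eq {M : Finset (FisherEdge n)} (hM : IsPerfect M) :
    matchingSign M = parityChar ℂ (signExponent M) := by
  rw [matchingSign, pairingSign, signExponent, AddChar.map_add_eq_mul, parityChar_sum,
    parityChar_sum]
  congr 1
  · exact prod_congr rfl fun e _ => orderSign_fisherEnum e.fst_ne_snd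
  · refine prod_congr rfl fun e he => ?_
    rw [parityChar_sum]
    refine prod_congr rfl fun e' he' => ?_
    split_ifs with hlt
    · have hne : e ≠ e' := fun h => by
        rw [h] at hlt
        exact edgeLt_asymm _ _ hlt hlt
      have hd : ∀ w w', e.incidence w ≠ 0 → e'.incidence w' ≠ 0 → w ≠ w' := by
        rintro w w' h1 h2 rfl
        exact (hM.disjoint he he' hne w).elim h1 h2
      have hf := e.incidence_fst_ne_zero
      have hs := e.incidence_snd_ne_zero
      have hf' := e'.incidence_fst_ne_zero
      have hs' := e'.incidence_snd_ne_zero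
      simp only [crossSign, crossing, AddChar.map_add_eq_mul]
      rw [orderSign_fisherEnum (hd _ _ hf hf'), orderSign_fisherEnum (hd _ _ hf hs'),
        orderSign_fisherEnum (hd _ _ hs hf'), orderSign_fisherEnum (hd _ _ hs hs')]
    · rw [AddChar.map_zero_eq_one]

/-- A vertex shared by two edges makes an order sign vanish. Hence the edges are disjoint, and there
are enough of them to cover every vertex. -/
theorem isPerfect_of_matchingSign_ne_zero {M : Finset (FisherEdge n)}
    (hcard : M.card = 3 * n * n) (h : matchingSign M ≠ 0) : IsPerfect M := by
  refine isPerfect_of_card hcard fun e he e' he' hne w => ?_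
  have key : ∀ e ∈ M, ∀ e' ∈ M, edgeLt e e' → ∀ w,
      e.incidence w = 0 ∨ e'.incidence w = 0 := by
    intro e he e' he' hlt w
    have h1 := (mul_ne_zero_iff.1 h).2
    have h2 := prod_ne_zero_iff.1 (prod_ne_zero_iff.1 h1 e he) e' he'
    rw [if_pos hlt] at h2
    have h3 : ∀ u v : FisherVertex n, orderSign (fisherEnum n u) (fisherEnum n v) ≠ 0 → u ≠ v := by
      rintro u v h rfl
      exact h (orderSign_self _)
    simp only [crossSign, mul_ne_zero_iff] at h2
    have h4 := h3 _ _ h2.1.1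
    have h5 := h3 _ _ h2.1.2
    have h6 := h3 _ _ h2.2.1
    have h7 := h3 _ _ h2.2.2
    by_contra! hw
    simp only [FisherEdge.incidence] at hw
    by_cases a1 : e.fst = w <;> by_cases a2 : e.snd = w <;> by_cases a3 : e'.fst = w <;>
      by_cases a4 : e'.snd = w <;> simp_all
  rcases edgeLt_total e e' hne with hlt | hlt
  · exact key e he e' he' hlt w
  · exact (key e' he' e he hlt w).symm

namespace GridChain

theorem sum_matching (p : GridChain n) (F : FisherEdge n → ZMod 2) :
    ∑ e ∈ p.matching, F e = ∑ k, ∑ s : Fin n × Fin n, p.occ k s * F (s.1, s.2, k) := by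
  rw [matching, sum_filter, FisherEdge.sum_eq]
  refine sum_congr rfl fun k _ => sum_congr rfl fun s _ => ?_
  have h : ∀ a b : ZMod 2, (if a = 1 then b else 0) = a * b := by decide
  exact h _ _

/-- Number of inversions between the ends of two edges, in coordinates. -/
theorem crossing_mk (s t : Fin n × Fin n) (k k' : FisherKind) :
    crossing (s.1, s.2, k) (t.1, t.2, k') =
      siteLt t s + siteLt (k'.shift t) s +
        (siteLt t (k.shift s) + siteLt (k'.shift t) (k.shift s)) +
      (eqInd t s * cornerLt k'.fst k.fst + eqInd (k'.shift t) s * cornerLt k'.snd k.fst +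
        (eqInd t (k.shift s) * cornerLt k'.fst k.snd +
          eqInd (k'.shift t) (k.shift s) * cornerLt k'.snd k.snd)) := by
  simp only [crossing, FisherEdge.fst_mk, FisherEdge.snd_mk, inversion_mk]
  ring

/-- The kinds of the edges inside a gadget. -/
def innerKinds : Finset FisherKind := {.mid, .ur, .rp, .pu, .dl, .lq, .qd}

omit [NeZero n] in
theorem sum_eq_hor_add_ver_add_inner (F : FisherKind → ZMod 2) :
    ∑ k, F k = F .hor + F .ver + ∑ k ∈ innerKinds, F k := by
  have h : (univ : Finset FisherKind) = insert .hor (insert .ver innerKinds) := rfl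
  rw [h, sum_insert (by decide), sum_insert (by decide), add_assoc]

theorem shift_inner {k : FisherKind} (hk : k ∈ innerKinds) (s : Fin n × Fin n) :
    k.shift s = s := by
  cases k <;> first | rfl | exact absurd hk (by decide)

/-- Both ends of an inner edge lie at one site, so comparisons with other sites occur twice and
cancel. Only the gadgets at the ends of the other edge matter. -/
theorem crossing_inner {k' : FisherKind} (hk' : k' ∈ innerKinds) (s t : Fin n × Fin n)
    (k : FisherKind) :
    crossing (s.1, s.2, k) (t.1, t.2, k') =
      eqInd t s * (cornerLt k'.fst k.fst + cornerLt k'.snd k.fst) +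
        eqInd t (k.shift s) * (cornerLt k'.fst k.snd + cornerLt k'.snd k.snd) := by
  rw [crossing_mk, shift_inner hk']
  have h1 := ZMod.two_add_self (siteLt t s)
  have h2 := ZMod.two_add_self (siteLt t (k.shift s))
  linear_combination h1 + h2

theorem sum_crossing_inner (p : GridChain n) {k' : FisherKind} (hk' : k' ∈ innerKinds)
    (k : FisherKind) :
    ∑ s : Fin n × Fin n, ∑ t : Fin n × Fin n,
      p.occ k s * p.occ k' t * crossing (s.1, s.2, k) (t.1, t.2, k') =
    ∑ s, (p.occ k s * p.occ k' s * (cornerLt k'.fst k.fst + cornerLt k'.snd k.fst) +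
      p.occ k s * p.occ k' (k.shift s) * (cornerLt k'.fst k.snd + cornerLt k'.snd k.snd)) := by
  refine sum_congr rfl fun s _ => ?_
  have h : ∀ t : Fin n × Fin n, p.occ k s * p.occ k' t * crossing (s.1, s.2, k) (t.1, t.2, k') =
      p.occ k s * p.occ k' t * (cornerLt k'.fst k.fst + cornerLt k'.snd k.fst) * eqInd t s +
      p.occ k s * p.occ k' t * (cornerLt k'.fst k.snd + cornerLt k'.snd k.snd) *
        eqInd t (k.shift s) := by
    intro t
    rw [crossing_inner hk']
    ring
  simp_rw [h, sum_add_distrib, sum_mul_eqInd]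

theorem sum_siteLt_crossing_inner (p : GridChain n) {k : FisherKind} (hk : k ∈ innerKinds) :
    ∑ s : Fin n × Fin n, ∑ t : Fin n × Fin n,
      siteLt s t * (p.occ k s * p.occ k t * crossing (s.1, s.2, k) (t.1, t.2, k)) = 0 := by
  refine sum_eq_zero fun s _ => sum_eq_zero fun t _ => ?_
  rw [crossing_inner hk, shift_inner hk]
  by_cases h : t = s
  · rw [h, siteLt_self, zero_mul]
  · simp [eqInd, h]

/-- The sign exponent of the part of a matching inside a gadget. -/
def gadgetExponent (r l u d : ZMod 2) : ZMod 2 :=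
  (∑ k ∈ innerKinds, gadgetMatching r l u d k * cornerLt k.snd k.fst) +
    (∑ k ∈ innerKinds, ∑ k' ∈ innerKinds, ltInd k.rank k'.rank *
      (gadgetMatching r l u d k * gadgetMatching r l u d k' *
        (cornerLt k'.fst k.fst + cornerLt k'.snd k.fst +
          (cornerLt k'.fst k.snd + cornerLt k'.snd k.snd)))) +
    ∑ k' ∈ innerKinds, gadgetMatching r l u d k' *
      (r * (cornerLt k'.fst .R + cornerLt k'.snd .R) +
        l * (cornerLt k'.fst .L + cornerLt k'.snd .L) +
        (u * (cornerLt k'.fst .U + cornerLt k'.snd .U) +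
        d * (cornerLt k'.fst .D + cornerLt k'.snd .D)))

/-- The added products are the local terms left by pairs of grid edges, moved to the site where they
meet: `l * u` from two horizontal edges, `u * d` from two vertical ones, `r * d + l * d` from mixed
pairs. The right side sums to zero over the torus. -/
theorem gadgetExponent_eq : ∀ r l u d : ZMod 2, r + l + u + d = 0 →
    gadgetExponent r l u d + (l * u + r * d + l * d + u * d) =
      1 + r + u + (r * u + r * l + l * u) := by
  decide

theorem shift_hor (s : Fin n × Fin n) : FisherKind.hor.shift s = siteRight s := rfl

theorem shift_ver (s : Fin n × Fin n) : FisherKind.ver.shift s = siteUp s := rfl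

theorem occ_hor (p : GridChain n) (s : Fin n × Fin n) : p.occ .hor s = p.1 s := rfl

theorem occ_ver (p : GridChain n) (s : Fin n × Fin n) : p.occ .ver s = p.2 s := rfl

/-- Only edges wrapping from the last column to the first have their second end numbered before
their first. -/
theorem sum_occ_hor_inversion (hn : Even n) (p : GridChain n) :
    ∑ s, p.occ .hor s * (siteLt (FisherKind.hor.shift s) s +
      eqInd (FisherKind.hor.shift s) s * cornerLt FisherKind.hor.snd FisherKind.hor.fst) =
      p.windX := by
  have e : ∀ s : Fin n × Fin n, p.occ .hor s * (siteLt (FisherKind.hor.shift s) s +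
      eqInd (FisherKind.hor.shift s) s * cornerLt FisherKind.hor.snd FisherKind.hor.fst) =
      p.1 s * eqInd s.1 (-1) := by
    intro s
    have h := siteLt_add_siteLt_siteRight s s
    have h0 : ltInd s.2 s.2 = 0 := by simp [ltInd]
    rw [siteLt_self, eqInd_comm (s.1 + 1), eqInd_self_add_one hn, h0] at h
    have h1 : cornerLt FisherKind.hor.snd FisherKind.hor.fst = 0 := by decide
    rw [h1, shift_hor, occ_hor]
    linear_combination p.1 s * h
  simp_rw [e]
  rw [Fintype.sum_prod_type_right]
  exact sum_congr rfl fun y _ => sum_mul_eqInd (fun x => p.1 (x, y)) (-1)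

theorem sum_occ_ver_inversion (hn : Even n) (p : GridChain n) :
    ∑ s, p.occ .ver s * (siteLt (FisherKind.ver.shift s) s +
      eqInd (FisherKind.ver.shift s) s * cornerLt FisherKind.ver.snd FisherKind.ver.fst) =
      p.windY := by
  have e : ∀ s : Fin n × Fin n, p.occ .ver s * (siteLt (FisherKind.ver.shift s) s +
      eqInd (FisherKind.ver.shift s) s * cornerLt FisherKind.ver.snd FisherKind.ver.fst) =
      p.2 s * eqInd s.2 (-1) := by
    intro s
    have h := siteLt_add_siteLt_siteUp s s
    rw [siteLt_self, eqInd_comm (s.2 + 1), eqInd_self_add_one hn, eqInd_self] at h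
    have h1 : cornerLt FisherKind.ver.snd FisherKind.ver.fst = 0 := by decide
    rw [h1, shift_ver, occ_ver]
    linear_combination p.2 s * h
  simp_rw [e]
  rw [Fintype.sum_prod_type]
  exact sum_congr rfl fun x _ => sum_mul_eqInd (fun y => p.2 (x, y)) (-1)

theorem sum_occ_inner_inversion (p : GridChain n) :
    ∀ k ∈ innerKinds, ∑ s, p.occ k s * (siteLt (k.shift s) s +
    eqInd (k.shift s) s * cornerLt k.snd k.fst) = ∑ s, p.occ k s * cornerLt k.snd k.fst := by
  intro k hk
  refine sum_congr rfl fun s _ => ?_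
  rw [shift_inner hk, siteLt_self, eqInd_self, zero_add, one_mul]

/-- Since `edgeLt` compares kinds first, pairs of different kinds are summed over all pairs of
sites, and the order of sites enters only within one kind. -/
theorem sum_pairs_matching (p : GridChain n) :
    ∑ e ∈ p.matching, ∑ e' ∈ p.matching, (if edgeLt e e' then crossing e e' else 0) =
    (∑ k, ∑ k', ltInd k.rank k'.rank * ∑ s : Fin n × Fin n, ∑ t : Fin n × Fin n,
      p.occ k s * p.occ k' t * crossing (s.1, s.2, k) (t.1, t.2, k')) +
    ∑ k, ∑ s : Fin n × Fin n, ∑ t : Fin n × Fin n, siteLt s t *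
      (p.occ k s * p.occ k t * crossing (s.1, s.2, k) (t.1, t.2, k)) := by
  have e0 : ∀ (k k' : FisherKind) (s t : Fin n × Fin n), p.occ k s * (p.occ k' t *
      (if edgeLt (s.1, s.2, k) (t.1, t.2, k') then
        crossing (s.1, s.2, k) (t.1, t.2, k') else 0)) =
      ltInd k.rank k'.rank * (p.occ k s * p.occ k' t *
        crossing (s.1, s.2, k) (t.1, t.2, k')) +
      siteLt s t * (p.occ k s * p.occ k' t *
        crossing (s.1, s.2, k) (t.1, t.2, k')) * eqInd k' k := by
    intro k k' s t
    have h := edgeLt_mk s t k k'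
    have h' : (if edgeLt (s.1, s.2, k) (t.1, t.2, k') then
        crossing (s.1, s.2, k) (t.1, t.2, k') else 0) =
        (if edgeLt (s.1, s.2, k) (t.1, t.2, k') then 1 else 0) *
          crossing (s.1, s.2, k) (t.1, t.2, k') := by
      split_ifs <;> simp
    rw [h', h, eqInd_comm k k']
    ring
  have e1 : ∀ (k : FisherKind) (s : Fin n × Fin n), p.occ k s * ∑ e' ∈ p.matching,
      (if edgeLt (s.1, s.2, k) e' then crossing (s.1, s.2, k) e' else 0) =
      (∑ k', ∑ t : Fin n × Fin n, ltInd k.rank k'.rank * (p.occ k s * p.occ k' t *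
        crossing (s.1, s.2, k) (t.1, t.2, k'))) +
      ∑ t : Fin n × Fin n, siteLt s t * (p.occ k s * p.occ k t *
        crossing (s.1, s.2, k) (t.1, t.2, k)) := by
    intro k s
    rw [sum_matching, mul_sum]
    have e2 : ∀ k', p.occ k s * ∑ t : Fin n × Fin n, p.occ k' t *
        (if edgeLt (s.1, s.2, k) (t.1, t.2, k') then
          crossing (s.1, s.2, k) (t.1, t.2, k') else 0) =
        (∑ t : Fin n × Fin n, ltInd k.rank k'.rank * (p.occ k s * p.occ k' t *
          crossing (s.1, s.2, k) (t.1, t.2, k'))) +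
        (∑ t : Fin n × Fin n, siteLt s t * (p.occ k s * p.occ k' t *
          crossing (s.1, s.2, k) (t.1, t.2, k'))) * eqInd k' k := by
      intro k'
      rw [mul_sum, sum_mul, ← sum_add_distrib]
      exact sum_congr rfl fun t _ => e0 k k' s t
    rw [sum_congr rfl fun k' _ => e2 k', sum_add_distrib]
    congr 1
    exact sum_mul_eqInd (fun k' => ∑ t : Fin n × Fin n, siteLt s t *
      (p.occ k s * p.occ k' t * crossing (s.1, s.2, k) (t.1, t.2, k'))) k
  rw [sum_matching, ← sum_add_distrib]
  refine sum_congr rfl fun k _ => ?_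
  rw [sum_congr rfl fun s _ => e1 k s, sum_add_distrib]
  congr 1
  rw [sum_comm]
  refine sum_congr rfl fun k' _ => ?_
  rw [mul_sum]
  exact sum_congr rfl fun s _ => (mul_sum _ _ _).symm

theorem sum_crossing_hor_ver {p : GridChain n} (hp : p.IsEven) :
    ∑ s : Fin n × Fin n, ∑ t : Fin n × Fin n, p.occ .hor s * p.occ .ver t *
    crossing (s.1, s.2, .hor) (t.1, t.2, .ver) =
    ∑ s, p.1 s * (p.2 (s.1, s.2 - 1) + p.2 (s.1 + 1, s.2 - 1)) := by
  rw [← sum_hor_ver hp]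
  refine sum_congr rfl fun s _ => sum_congr rfl fun t _ => ?_
  rw [crossing_mk]
  have h1 : cornerLt .U .R = 0 := by decide
  have h2 : cornerLt .D .R = 0 := by decide
  have h3 : cornerLt .U .L = 0 := by decide
  have h4 : cornerLt .D .L = 0 := by decide
  simp only [shift_hor, shift_ver, occ_hor, occ_ver, FisherKind.fst, FisherKind.snd, h1, h2, h3, h4, mul_zero, add_zero]

theorem sum_crossing_hor_hor (hn : Even n) {p : GridChain n} (hp : p.IsEven) :
    ∑ s : Fin n × Fin n, ∑ t : Fin n × Fin n, siteLt s t *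
    (p.occ .hor s * p.occ .hor t * crossing (s.1, s.2, .hor) (t.1, t.2, .hor)) =
    p.windX * p.windY + ∑ s, p.1 s * p.2 (siteRight s) := by
  rw [← sum_hor_hor hn hp]
  refine sum_congr rfl fun s _ => sum_congr rfl fun t _ => ?_
  rw [crossing_mk]
  have h1 : cornerLt .R .R = 0 := by decide
  have h2 : cornerLt .L .R = 0 := by decide
  have h3 : cornerLt .R .L = 1 := by decide
  have h4 : cornerLt .L .L = 0 := by decide
  simp only [shift_hor, occ_hor, FisherKind.fst, FisherKind.snd, h1, h2, h3, h4, mul_zero, add_zero,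
    zero_add, mul_one]

theorem sum_crossing_ver_ver (hn : Even n) (p : GridChain n) :
    ∑ s : Fin n × Fin n, ∑ t : Fin n × Fin n, siteLt s t *
    (p.occ .ver s * p.occ .ver t * crossing (s.1, s.2, .ver) (t.1, t.2, .ver)) =
    ∑ s, p.2 s * p.2 (siteUp s) := by
  rw [← sum_ver_ver hn]
  refine sum_congr rfl fun s _ => sum_congr rfl fun t _ => ?_
  rw [crossing_mk]
  have h1 : cornerLt .U .U = 0 := by decide
  have h2 : cornerLt .D .U = 0 := by decide
  have h3 : cornerLt .U .D = 1 := by decide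
  have h4 : cornerLt .D .D = 0 := by decide
  simp only [shift_ver, occ_ver, FisherKind.fst, FisherKind.snd, h1, h2, h3, h4, mul_zero, add_zero,
    zero_add, mul_one]

theorem sum_crossing_same_kind (hn : Even n) {p : GridChain n} (hp : p.IsEven) :
    ∑ k, ∑ s : Fin n × Fin n, ∑ t : Fin n × Fin n, siteLt s t *
    (p.occ k s * p.occ k t * crossing (s.1, s.2, k) (t.1, t.2, k)) =
    p.windX * p.windY + ∑ s, p.1 s * p.2 (siteRight s) + ∑ s, p.2 s * p.2 (siteUp s) := by
  rw [sum_eq_hor_add_ver_add_inner, sum_crossing_hor_hor hn hp, sum_crossing_ver_ver hn,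
    sum_eq_zero fun k hk => p.sum_siteLt_crossing_inner hk, add_zero]

theorem sum_crossing_kind_lt {p : GridChain n} (hp : p.IsEven) :
    ∑ k, ∑ k', ltInd k.rank k'.rank * ∑ s : Fin n × Fin n, ∑ t : Fin n × Fin n,
    p.occ k s * p.occ k' t * crossing (s.1, s.2, k) (t.1, t.2, k') =
    ∑ s, p.1 s * (p.2 (s.1, s.2 - 1) + p.2 (s.1 + 1, s.2 - 1)) +
    (∑ k' ∈ innerKinds, ∑ s : Fin n × Fin n, p.occ k' s *
      (p.1 s * (cornerLt k'.fst .R + cornerLt k'.snd .R) +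
        p.1 (s.1 - 1, s.2) * (cornerLt k'.fst .L + cornerLt k'.snd .L))) +
    (∑ k' ∈ innerKinds, ∑ s : Fin n × Fin n, p.occ k' s *
      (p.2 s * (cornerLt k'.fst .U + cornerLt k'.snd .U) +
        p.2 (s.1, s.2 - 1) * (cornerLt k'.fst .D + cornerLt k'.snd .D))) +
    ∑ k ∈ innerKinds, ∑ k' ∈ innerKinds, ∑ s : Fin n × Fin n, ltInd k.rank k'.rank *
      (p.occ k s * p.occ k' s * (cornerLt k'.fst k.fst + cornerLt k'.snd k.fst +
        (cornerLt k'.fst k.snd + cornerLt k'.snd k.snd))) := by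
  have z1 : ltInd FisherKind.hor.rank FisherKind.hor.rank = 0 := by decide
  have z2 : ltInd FisherKind.hor.rank FisherKind.ver.rank = 1 := by decide
  have z3 : ltInd FisherKind.ver.rank FisherKind.hor.rank = 0 := by decide
  have z4 : ltInd FisherKind.ver.rank FisherKind.ver.rank = 0 := by decide
  have z5 : ∀ k ∈ innerKinds, ltInd k.rank FisherKind.hor.rank = 0 := by decide
  have z6 : ∀ k ∈ innerKinds, ltInd k.rank FisherKind.ver.rank = 0 := by decide
  have z7 : ∀ k ∈ innerKinds, ltInd FisherKind.hor.rank k.rank = 1 := by decide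
  have z8 : ∀ k ∈ innerKinds, ltInd FisherKind.ver.rank k.rank = 1 := by decide
  simp_rw [sum_eq_hor_add_ver_add_inner]
  rw [z1, z2, z3, z4, sum_crossing_hor_ver hp]
  have i1 : ∑ k' ∈ innerKinds, ltInd FisherKind.hor.rank k'.rank *
      ∑ s : Fin n × Fin n, ∑ t : Fin n × Fin n, p.occ .hor s * p.occ k' t *
        crossing (s.1, s.2, .hor) (t.1, t.2, k') =
      ∑ k' ∈ innerKinds, ∑ s : Fin n × Fin n, p.occ k' s *
        (p.1 s * (cornerLt k'.fst .R + cornerLt k'.snd .R) +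
        p.1 (s.1 - 1, s.2) * (cornerLt k'.fst .L + cornerLt k'.snd .L)) := by
    refine sum_congr rfl fun k' hk' => ?_
    rw [z7 k' hk', one_mul, p.sum_crossing_inner hk', sum_add_distrib,
      ← sum_comp_left fun s => p.occ .hor s * p.occ k' (FisherKind.hor.shift s) *
        (cornerLt k'.fst FisherKind.hor.snd + cornerLt k'.snd FisherKind.hor.snd),
      ← sum_add_distrib]
    refine sum_congr rfl fun s _ => ?_
    have e : FisherKind.hor.shift (s.1 - 1, s.2) = s :=
      FisherKind.hor.shift.apply_symm_apply s
    rw [e]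
    simp only [FisherKind.fst, FisherKind.snd, occ, gadgetMatching]
    ring
  have i2 : ∑ k' ∈ innerKinds, ltInd FisherKind.ver.rank k'.rank *
      ∑ s : Fin n × Fin n, ∑ t : Fin n × Fin n, p.occ .ver s * p.occ k' t *
        crossing (s.1, s.2, .ver) (t.1, t.2, k') =
      ∑ k' ∈ innerKinds, ∑ s : Fin n × Fin n, p.occ k' s *
        (p.2 s * (cornerLt k'.fst .U + cornerLt k'.snd .U) +
        p.2 (s.1, s.2 - 1) * (cornerLt k'.fst .D + cornerLt k'.snd .D)) := by
    refine sum_congr rfl fun k' hk' => ?_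
    rw [z8 k' hk', one_mul, p.sum_crossing_inner hk', sum_add_distrib,
      ← sum_comp_down fun s => p.occ .ver s * p.occ k' (FisherKind.ver.shift s) *
        (cornerLt k'.fst FisherKind.ver.snd + cornerLt k'.snd FisherKind.ver.snd),
      ← sum_add_distrib]
    refine sum_congr rfl fun s _ => ?_
    have e : FisherKind.ver.shift (s.1, s.2 - 1) = s :=
      FisherKind.ver.shift.apply_symm_apply s
    rw [e]
    simp only [FisherKind.fst, FisherKind.snd, occ, gadgetMatching]
    ring
  rw [i1, i2]
  have i3 : ∀ k ∈ innerKinds, (ltInd k.rank FisherKind.hor.rank *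
      (∑ s : Fin n × Fin n, ∑ t : Fin n × Fin n, p.occ k s * p.occ .hor t *
        crossing (s.1, s.2, k) (t.1, t.2, .hor)) + ltInd k.rank FisherKind.ver.rank *
      (∑ s : Fin n × Fin n, ∑ t : Fin n × Fin n, p.occ k s * p.occ .ver t *
        crossing (s.1, s.2, k) (t.1, t.2, .ver)) + ∑ k' ∈ innerKinds, ltInd k.rank k'.rank *
      ∑ s : Fin n × Fin n, ∑ t : Fin n × Fin n, p.occ k s * p.occ k' t *
        crossing (s.1, s.2, k) (t.1, t.2, k')) =
      ∑ k' ∈ innerKinds, ∑ s : Fin n × Fin n, ltInd k.rank k'.rank *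
        (p.occ k s * p.occ k' s * (cornerLt k'.fst k.fst + cornerLt k'.snd k.fst +
        (cornerLt k'.fst k.snd + cornerLt k'.snd k.snd))) := by
    intro k hk
    rw [z5 k hk, z6 k hk, zero_mul, zero_mul, zero_add, zero_add]
    refine sum_congr rfl fun k' hk' => ?_
    rw [p.sum_crossing_inner hk', mul_sum]
    refine sum_congr rfl fun s _ => ?_
    rw [shift_inner hk]
    ring
  rw [sum_congr rfl i3]
  ring

theorem sum_gadgetExponent (hn : Even n) {p : GridChain n} (hp : p.IsEven) : ∑ s : Fin n × Fin n,
    (gadgetExponent (p.1 s) (p.1 (s.1 - 1, s.2)) (p.2 s) (p.2 (s.1, s.2 - 1)) +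
      (p.1 (s.1 - 1, s.2) * p.2 s + p.1 s * p.2 (s.1, s.2 - 1) +
        p.1 (s.1 - 1, s.2) * p.2 (s.1, s.2 - 1) + p.2 s * p.2 (s.1, s.2 - 1))) = 0 := by
  have e : ∀ s : Fin n × Fin n, _ := fun s => gadgetExponent_eq _ _ _ _ (hp s.1 s.2)
  simp only [Prod.mk.eta] at e
  simp_rw [e]
  rw [sum_add_distrib, hp.sum_half_degree hn]
  simp_rw [sum_add_distrib]
  rw [hp.sum_hor hn, hp.sum_ver hn, Fintype.sum_prod_type]
  simp_rw [sum_const_eq_zero hn]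
  simp

theorem sum_gadgetExponent_eq (p : GridChain n) :
    ∑ s : Fin n × Fin n, gadgetExponent (p.1 s) (p.1 (s.1 - 1, s.2)) (p.2 s) (p.2 (s.1, s.2 - 1)) =
      (∑ k ∈ innerKinds, ∑ s, p.occ k s * cornerLt k.snd k.fst) +
      (∑ k ∈ innerKinds, ∑ k' ∈ innerKinds, ∑ s : Fin n × Fin n, ltInd k.rank k'.rank *
        (p.occ k s * p.occ k' s * (cornerLt k'.fst k.fst + cornerLt k'.snd k.fst +
          (cornerLt k'.fst k.snd + cornerLt k'.snd k.snd)))) +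
      ((∑ k' ∈ innerKinds, ∑ s : Fin n × Fin n, p.occ k' s *
        (p.1 s * (cornerLt k'.fst .R + cornerLt k'.snd .R) +
          p.1 (s.1 - 1, s.2) * (cornerLt k'.fst .L + cornerLt k'.snd .L))) +
      ∑ k' ∈ innerKinds, ∑ s : Fin n × Fin n, p.occ k' s *
        (p.2 s * (cornerLt k'.fst .U + cornerLt k'.snd .U) +
          p.2 (s.1, s.2 - 1) * (cornerLt k'.fst .D + cornerLt k'.snd .D))) := by
  unfold gadgetExponent
  rw [sum_add_distrib, sum_add_distrib]
  congr 1
  · congr 1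
    · exact sum_comm
    · rw [sum_comm]
      exact sum_congr rfl fun k _ => sum_comm
  · rw [sum_comm, ← sum_add_distrib]
    refine sum_congr rfl fun k' _ => ?_
    rw [← sum_add_distrib]
    exact sum_congr rfl fun s _ => mul_add _ _ _

/-- The linear terms come from single edges that wrap around, the product from pairs of horizontal
edges. Everything else is moved by translations to a common site, where it is cancelled by
`sum_gadgetExponent`. -/
theorem signExponent_matching (hn : Even n) {p : GridChain n} (hp : p.IsEven) :
    signExponent p.matching = p.windX + p.windY + p.windX * p.windY := by
  have hsingle : ∀ k, ∑ s : Fin n × Fin n, p.occ k s *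
      inversion (FisherEdge.fst (s.1, s.2, k)) (FisherEdge.snd (s.1, s.2, k)) =
      ∑ s, p.occ k s * (siteLt (k.shift s) s + eqInd (k.shift s) s * cornerLt k.snd k.fst) := by
    intro k
    simp only [FisherEdge.fst_mk, FisherEdge.snd_mk, inversion_mk]
  have r1 : ∑ s, p.1 s * p.2 (siteRight s) = ∑ s : Fin n × Fin n, p.1 (s.1 - 1, s.2) * p.2 s := by
    rw [← sum_comp_left fun s => p.1 s * p.2 (siteRight s)]
    simp [siteRight]
  have r2 : ∑ s, p.2 s * p.2 (siteUp s) = ∑ s : Fin n × Fin n, p.2 s * p.2 (s.1, s.2 - 1) := by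
    rw [← sum_comp_down fun s => p.2 s * p.2 (siteUp s)]
    simp [siteUp, mul_comm]
  have r3 : ∑ s, p.1 s * (p.2 (s.1, s.2 - 1) + p.2 (s.1 + 1, s.2 - 1)) =
      ∑ s : Fin n × Fin n, p.1 s * p.2 (s.1, s.2 - 1) +
        ∑ s : Fin n × Fin n, p.1 (s.1 - 1, s.2) * p.2 (s.1, s.2 - 1) := by
    simp_rw [mul_add, sum_add_distrib]
    congr 1
    rw [← sum_comp_left fun s => p.1 s * p.2 (s.1 + 1, s.2 - 1)]
    simp
  have hlocal := sum_gadgetExponent hn hp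
  rw [signExponent, sum_matching, sum_pairs_matching, sum_crossing_same_kind hn hp,
    sum_crossing_kind_lt hp]
  simp_rw [hsingle]
  rw [sum_eq_hor_add_ver_add_inner, sum_congr rfl p.sum_occ_inner_inversion]
  rw [sum_occ_hor_inversion hn, sum_occ_ver_inversion hn, r1, r2, r3]
  rw [sum_add_distrib, sum_gadgetExponent_eq] at hlocal
  simp only [sum_add_distrib] at hlocal ⊢
  linear_combination hlocal

end GridChain

end MatchingSign

/-! ### Orientation and monodromy signs, and the Pfaffian by homology classes. -/

section FisherPfaffian

open Finset

variable {n : ℕ} [NeZero n]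

/-- Exponent of the sign of an edge: its orientation. -/
def FisherOrientation.exponent (o : FisherOrientation) (k : FisherKind) : ZMod 2 :=
  if o k then 0 else 1

/-- The listed sides run clockwise, so an odd number of the three has exponent 0 and an even number
has exponent 1. -/
theorem FisherOrientation.ClockwiseOdd.exponent_ur {o : FisherOrientation} (ho : o.ClockwiseOdd) :
    o.exponent .ur + o.exponent .rp + o.exponent .pu = 0 := by
  have h := ho .triangleRU
  simp only [FisherFace.boundary, FisherOrientation.exponent, List.countP_cons, List.countP_nil] at *
  revert h
  generalize o .ur = a
  generalize o .rp = b
  generalize o .pu = c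
  revert a b c
  decide

theorem FisherOrientation.ClockwiseOdd.exponent_dl {o : FisherOrientation} (ho : o.ClockwiseOdd) :
    o.exponent .dl + o.exponent .lq + o.exponent .qd = 0 := by
  have h := ho .triangleLD
  simp only [FisherFace.boundary, FisherOrientation.exponent, List.countP_cons, List.countP_nil] at *
  revert h
  generalize o .dl = a
  generalize o .lq = b
  generalize o .qd = c
  revert a b c
  decide

/-- Exponent of the sign given to an edge by the monodromy if `z = (-1) ^ ζ` and `w = (-1) ^ ξ`. -/
def monodromyExponent (ζ ξ : ZMod 2) (k : FisherKind) (s : Fin n × Fin n) : ZMod 2 :=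
  match k with
  | .hor => ξ * eqInd s.1 (-1)
  | .ver => ζ * eqInd s.2 (-1)
  | _ => 0

/-- Exponent of the sign of an edge in the Kasteleyn matrix. -/
def edgeExponent (o : FisherOrientation) (ζ ξ : ZMod 2) (e : FisherEdge n) : ZMod 2 :=
  o.exponent e.2.2 + monodromyExponent ζ ξ e.2.2 (e.1, e.2.1)

theorem parityChar_inv (t : ZMod 2) : (parityChar ℂ t)⁻¹ = parityChar ℂ t := by
  rw [parityChar_apply]
  split_ifs <;> norm_num

theorem monodromy_eq (ζ ξ : ZMod 2) (e : FisherEdge n) :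
    e.monodromy (parityChar ℂ ζ) (parityChar ℂ ξ) =
      parityChar ℂ (monodromyExponent ζ ξ e.2.2 (e.1, e.2.1)) := by
  obtain ⟨x, y, k⟩ := e
  cases k
  · simp only [FisherEdge.monodromy, monodromyExponent, eqInd, eq_neg_iff_add_eq_zero]
    split_ifs <;> simp
  · simp only [FisherEdge.monodromy, monodromyExponent, eqInd, eq_neg_iff_add_eq_zero]
    split_ifs <;> simp
  all_goals simp [FisherEdge.monodromy, monodromyExponent]

/-- At a real point the monodromy equals its inverse, and reversing an edge changes its sign. Both
become a scalar sign on an edge with fixed first and second end. -/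
theorem fisherKasteleyn_eq_sum (o : FisherOrientation) (a b : Fin n → Fin n → ℝ) (ζ ξ : ZMod 2)
    (u v : FisherVertex n) :
    fisherKasteleyn o a b (parityChar ℂ ζ) (parityChar ℂ ξ) u v =
      ∑ e : FisherEdge n, (parityChar ℂ (edgeExponent o ζ ξ e) * (e.weight a b : ℂ)) *
        ((if u = e.fst ∧ v = e.snd then 1 else 0) - if v = e.fst ∧ u = e.snd then 1 else 0) := by
  refine sum_congr rfl fun e _ => ?_
  rw [monodromy_eq, parityChar_inv, edgeExponent, AddChar.map_add_eq_mul]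
  simp only [FisherEdge.tail, FisherEdge.head, FisherOrientation.exponent]
  by_cases h : o e.2.2
  · simp only [h, if_true, AddChar.map_zero_eq_one]
    split_ifs <;> ring
  · simp only [h, parityChar_apply (1 : ZMod 2), Bool.false_eq_true, if_false, one_ne_zero,
      and_comm (a := u = e.snd), and_comm (a := v = e.snd)]
    split_ifs <;> ring

theorem fisherKasteleyn_transpose (o : FisherOrientation) (a b : Fin n → Fin n → ℝ)
    (ζ ξ : ZMod 2) :
    (fisherKasteleyn o a b (parityChar ℂ ζ) (parityChar ℂ ξ)).transpose =
      -fisherKasteleyn o a b (parityChar ℂ ζ) (parityChar ℂ ξ) := by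
  ext u v
  rw [Matrix.transpose_apply, Matrix.neg_apply, fisherKasteleyn_eq_sum, fisherKasteleyn_eq_sum,
    ← sum_neg_distrib]
  exact sum_congr rfl fun e _ => by ring

theorem fisherPf_eq_zero_of_charPoly_eq_zero (o : FisherOrientation) (a b : Fin n → Fin n → ℝ)
    (ζ ξ : ZMod 2) (h : fisherCharPoly o a b (parityChar ℂ ζ) (parityChar ℂ ξ) = 0) :
    fisherPf o a b (parityChar ℂ ζ) (parityChar ℂ ξ) = 0 := by
  refine pfaffian_eq_zero_of_det_eq_zero _ ?_ ?_
  · rw [Matrix.transpose_reindex, fisherKasteleyn_transpose]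
    rfl
  · rw [Matrix.det_reindex_self]
    exact h

/-- The triangle conditions remove the quadratic terms: on even configurations the exponent of a
gadget is affine in the outer edges. -/
theorem gadget_orientation {α β γ δ l μ q : ZMod 2} (h1 : α + β + γ = 0) (h2 : δ + l + q = 0) :
    ∀ r l' u d : ZMod 2, r + l' + u + d = 0 →
    gadgetMatching r l' u d .mid * μ + (gadgetMatching r l' u d .ur * α +
      (gadgetMatching r l' u d .rp * β + (gadgetMatching r l' u d .pu * γ +
      (gadgetMatching r l' u d .dl * δ + (gadgetMatching r l' u d .lq * l +
      gadgetMatching r l' u d .qd * q))))) =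
      α + δ + μ + u * (α + μ + β + l) + d * δ + r * (μ + β + l) := by
  have h1' : γ = α + β := by grind [ZMod.two_add_self]
  have h2' : q = δ + l := by grind [ZMod.two_add_self]
  subst h1' h2'
  revert α β δ l μ
  have key : ∀ r l' u d : ZMod 2, r + l' + u + d = 0 → ∀ α β δ l μ : ZMod 2,
    gadgetMatching r l' u d .mid * μ + (gadgetMatching r l' u d .ur * α +
      (gadgetMatching r l' u d .rp * β + (gadgetMatching r l' u d .pu * (α + β) +
      (gadgetMatching r l' u d .dl * δ + (gadgetMatching r l' u d .lq * l +
      gadgetMatching r l' u d .qd * (δ + l)))))) =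
      α + δ + μ + u * (α + μ + β + l) + d * δ + r * (μ + β + l) := by decide
  intro α β δ l μ _ _ r l' u d h
  exact key r l' u d h α β δ l μ

namespace GridChain

/-- By translation invariance the affine gadget exponents have constant coefficients. They multiply
the number of sites and the numbers of horizontal and vertical edges, all even. -/
theorem sum_orientation (hn : Even n) {o : FisherOrientation} (ho : o.ClockwiseOdd)
    {p : GridChain n} (hp : p.IsEven) :
    ∑ k, ∑ s, p.occ k s * o.exponent k = 0 := by
  rw [sum_comm]
  have e : ∀ s : Fin n × Fin n, ∑ k, p.occ k s * o.exponent k =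
      o.exponent .ur + o.exponent .dl + o.exponent .mid +
      p.2 s * (o.exponent .ver + (o.exponent .ur + o.exponent .mid + o.exponent .rp +
        o.exponent .lq)) + p.2 (s.1, s.2 - 1) * o.exponent .dl +
      p.1 s * (o.exponent .hor + (o.exponent .mid + o.exponent .rp + o.exponent .lq)) := by
    intro s
    rw [FisherKind.sum_eq]
    have h := gadget_orientation (μ := o.exponent .mid) ho.exponent_ur ho.exponent_dl
      _ _ _ _ (hp s.1 s.2)
    simp only [Prod.mk.eta] at h
    simp only [occ]
    rw [h]
    simp only [gadgetMatching]
    ring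
  simp_rw [e, sum_add_distrib (M := ZMod 2), ← sum_mul]
  rw [sum_comp_down p.2, hp.sum_ver hn, hp.sum_hor hn]
  simp_rw [Fintype.sum_prod_type, sum_const_eq_zero hn]
  simp

theorem sum_monodromy (ζ ξ : ZMod 2) (p : GridChain n) :
    ∑ k, ∑ s, p.occ k s * monodromyExponent ζ ξ k s = ξ * p.windX + ζ * p.windY := by
  rw [sum_eq_hor_add_ver_add_inner, sum_eq_zero (s := innerKinds), add_zero]
  · simp only [occ_hor, occ_ver, monodromyExponent]
    congr 1
    · rw [Fintype.sum_prod_type_right, windX, mul_sum]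
      refine sum_congr rfl fun y _ => ?_
      rw [← sum_mul_eqInd (fun x => ξ * p.1 (x, y)) (-1)]
      exact sum_congr rfl fun x _ => by ring
    · rw [Fintype.sum_prod_type, windY, mul_sum]
      refine sum_congr rfl fun x _ => ?_
      rw [← sum_mul_eqInd (fun y => ζ * p.2 (x, y)) (-1)]
      exact sum_congr rfl fun y _ => by ring
  · intro k hk
    refine sum_eq_zero fun s _ => ?_
    cases k <;> first | exact absurd hk (by decide) | exact mul_zero _

theorem prod_weight_matching (a b : Fin n → Fin n → ℝ) (p : GridChain n) :
    ∏ e ∈ p.matching, FisherEdge.weight a b e = p.weight a b := by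
  have h1 : ∀ e : FisherEdge n, (if p.occ e.2.2 (e.1, e.2.1) = 1 then e.weight a b else 1) =
      match e with
      | (x, y, .hor) => if p.1 (x, y) = 0 then 1 else a x y
      | (x, y, .ver) => if p.2 (x, y) = 0 then 1 else b x y
      | _ => 1 := by
    have h01 : ∀ (t : ZMod 2) (W : ℝ), (if t = 1 then W else 1) = if t = 0 then 1 else W := by
      intro t W
      have h : t = 0 ∨ t = 1 := by
        revert t
        decide
      rcases h with rfl | rfl <;> simp
    rintro ⟨x, y, k⟩
    cases k
    · exact h01 _ _
    · exact h01 _ _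
    all_goals simp [FisherEdge.weight]
  rw [matching, prod_filter]
  simp_rw [h1]
  rw [weight, Fintype.prod_prod_type, Fintype.prod_prod_type]
  refine prod_congr rfl fun x _ => ?_
  rw [Fintype.prod_prod_type]
  refine prod_congr rfl fun y _ => ?_
  have h : (univ : Finset FisherKind) = {.hor, .ver, .mid, .ur, .rp, .pu, .dl, .lq, .qd} := rfl
  rw [h]
  repeat rw [prod_insert (by decide)]
  rw [prod_singleton]
  simp

end GridChain

/-- The Pfaffian at a real point of the torus as a signed sum over even subgraphs. -/
theorem fisherPf_eq_sum_even (hn : Even n) (o : FisherOrientation) (ho : o.ClockwiseOdd)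
    (a b : Fin n → Fin n → ℝ) (ζ ξ : ZMod 2) :
    fisherPf o a b (parityChar ℂ ζ) (parityChar ℂ ξ) =
      ∑ p : GridChain n with p.IsEven,
        parityChar ℂ (p.windX + p.windY + p.windX * p.windY + (ξ * p.windX + ζ * p.windY)) *
          (p.weight a b : ℂ) := by
  have hterm : ∀ p : GridChain n, p.IsEven → matchingSign p.matching *
      ∏ e ∈ p.matching, (parityChar ℂ (edgeExponent o ζ ξ e) * (e.weight a b : ℂ)) =
      parityChar ℂ (p.windX + p.windY + p.windX * p.windY + (ξ * p.windX + ζ * p.windY)) *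
          (p.weight a b : ℂ) := by
    intro p hp
    rw [prod_mul_distrib, ← Complex.ofReal_prod, p.prod_weight_matching, ← parityChar_sum,
      hp.isPerfect_matching.matchingSign_eq, GridChain.signExponent_matching hn hp, ← mul_assoc,
      ← AddChar.map_add_eq_mul, GridChain.sum_matching]
    simp only [edgeExponent, mul_add, sum_add_distrib]
    rw [GridChain.sum_orientation hn ho hp, p.sum_monodromy, zero_add]
  rw [fisherPf, pfaffian_eq_sum_pairingSign (ι := FisherEdge n) edgeLt edgeLt_asymm edgeLt_total
    (fun e => parityChar ℂ (edgeExponent o ζ ξ e) * (e.weight a b : ℂ))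
    (fun e => fisherEnum n e.fst) (fun e => fisherEnum n e.snd)]
  · rw [← sum_congr rfl fun p hp => hterm p (mem_filter.1 hp).2]
    rw [← sum_image (s := univ.filter fun p : GridChain n => p.IsEven)
      (g := GridChain.matching) (f := fun M => matchingSign M *
        ∏ e ∈ M, (parityChar ℂ (edgeExponent o ζ ξ e) * (FisherEdge.weight a b e : ℂ)))
      fun p _ q _ h => GridChain.matching_injective h]
    symm
    refine sum_subset ?_ ?_
    · intro M hM
      obtain ⟨p, hp, rfl⟩ := mem_image.1 hM
      exact mem_filter.2 ⟨mem_univ _, (mem_filter.1 hp).2.isPerfect_matching.card⟩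
    -- A nonzero term has a nonzero sign, so its set of edges is a perfect matching and comes from
    -- an even subgraph.
    · intro M hM hM'
      by_contra h
      obtain ⟨p, hp, rfl⟩ := (isPerfect_of_matchingSign_ne_zero (mem_filter.1 hM).2
        (left_ne_zero_of_mul h)).exists_matching
      exact hM' (mem_image_of_mem _ (mem_filter.2 ⟨mem_univ _, hp⟩))
  · intro u v
    rw [Matrix.reindex_apply, Matrix.submatrix_apply, fisherKasteleyn_eq_sum]
    simp only [Equiv.symm_apply_eq]

theorem fisherPf_eq_sum_partition (hn : Even n) (o : FisherOrientation) (ho : o.ClockwiseOdd)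
    (a b : Fin n → Fin n → ℝ) (ζ ξ : ZMod 2) :
    fisherPf o a b (parityChar ℂ ζ) (parityChar ℂ ξ) =
      ∑ i : ZMod 2, ∑ j : ZMod 2, parityChar ℂ (i + j + i * j + (ξ * i + ζ * j)) *
        (GridChain.partition a b i j : ℂ) := by
  rw [fisherPf_eq_sum_even hn o ho]
  rw [← Fintype.sum_prod_type' fun i j : ZMod 2 => parityChar ℂ (i + j + i * j + (ξ * i + ζ * j)) *
        (GridChain.partition a b i j : ℂ),
    ← sum_fiberwise_of_maps_to (t := univ) (g := fun p : GridChain n => (p.windX, p.windY))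
      fun p _ => mem_univ _]
  refine sum_congr rfl fun ij _ => ?_
  rw [GridChain.partition, Complex.ofReal_sum, mul_sum, filter_filter]
  refine sum_congr (filter_congr fun p _ => by rw [Prod.ext_iff]) fun p hp => ?_
  obtain ⟨_, h1, h2⟩ := (mem_filter.1 hp).2
  rw [h1, h2]

theorem fisherPf_pos (hn : Even n) (o : FisherOrientation) (ho : o.ClockwiseOdd)
    {a b : Fin n → Fin n → ℝ} (ha : ∀ x y, a x y ∈ Set.Ioo (0 : ℝ) 1)
    (hb : ∀ x y, b x y ∈ Set.Ioo (0 : ℝ) 1) {ζ ξ : ZMod 2} (h : ζ ≠ 0 ∨ ξ ≠ 0) :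
    0 < fisherPf o a b (parityChar ℂ ζ) (parityChar ℂ ξ) := by
  have hpos := GridChain.partition_pos ha hb
  have hle := GridChain.partition_le ha hb
  have h01 := hle 0 1
  have h10 := hle 1 0
  have h11 := hle 1 1
  have p01 := hpos 0 1
  have p10 := hpos 1 0
  have p11 := hpos 1 1
  rw [fisherPf_eq_sum_partition hn o ho]
  have hsum : ∀ F : ZMod 2 → ℂ, ∑ i, F i = F 0 + F 1 := fun F => Fin.sum_univ_two F
  rw [hsum, hsum, hsum]
  have hcases : ∀ t : ZMod 2, t = 0 ∨ t = 1 := by decide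
  have h2 : (1 + 1 : ZMod 2) = 0 := by decide
  rcases hcases ζ with rfl | rfl <;> rcases hcases ξ with rfl | rfl
  · simp at h
  -- In each case one of the classes (0, 1), (1, 0), (1, 1) has a minus sign; it is bounded by the
  -- class (0, 0), and the other two are positive.
  all_goals
    simp only [parityChar_apply, zero_add, add_zero, mul_zero, neg_mul, mul_one, one_mul, h2,
      if_true, one_ne_zero, if_false]
    norm_cast
    linarith

end FisherPfaffian

/-! ### Real nodes and positive Pfaffians. -/

theorem lemma4p12 (n : ℕ) [NeZero n] (hn : Even n)
    (o : FisherOrientation) (ho : o.ClockwiseOdd)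
    (a b : Fin n → Fin n → ℝ)
    (ha : ∀ x y, a x y ∈ Set.Ioo (0 : ℝ) 1) (hb : ∀ x y, b x y ∈ Set.Ioo (0 : ℝ) 1) :
    (∀ z w : ℂ, IsRealNode (fisherCharPoly o a b) z w → z = 1 ∧ w = 1) ∧
      0 < fisherPf o a b 1 (-1) ∧ 0 < fisherPf o a b (-1) 1 ∧ 0 < fisherPf o a b (-1) (-1) := by
  have h0 : parityChar ℂ 0 = 1 := AddChar.map_zero_eq_one _
  have h1 : parityChar ℂ 1 = -1 := by rw [parityChar_apply, if_neg one_ne_zero]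
  refine ⟨?_, ?_, ?_, ?_⟩
  · rintro z w ⟨hz, hw, hz', hw', hP, -, -⟩
    have key : ∀ z : ℂ, ‖z‖ = 1 → z.im = 0 → ∃ ζ, z = parityChar ℂ ζ := by
      intro z hz hz'
      have hre : z = (z.re : ℂ) := Complex.ext rfl hz'
      rw [hre, Complex.norm_real, Real.norm_eq_abs] at hz
      rcases eq_or_eq_neg_of_abs_eq hz with h | h
      · exact ⟨0, by rw [hre, h, h0, Complex.ofReal_one]⟩
      · exact ⟨1, by rw [hre, h, h1, Complex.ofReal_neg, Complex.ofReal_one]⟩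
    obtain ⟨ζ, rfl⟩ := key z hz hz'
    obtain ⟨ξ, rfl⟩ := key w hw hw'
    have hpf := fisherPf_eq_zero_of_charPoly_eq_zero o a b ζ ξ hP
    have h : ¬ (ζ ≠ 0 ∨ ξ ≠ 0) := fun h => (fisherPf_pos hn o ho ha hb h).ne' hpf
    push Not at h
    rw [h.1, h.2]
    exact ⟨h0, h0⟩
  · have h := fisherPf_pos hn o ho ha hb (ζ := 0) (ξ := 1) (Or.inr one_ne_zero)
    rwa [h0, h1] at h
  · have h := fisherPf_pos hn o ho ha hb (ζ := 1) (ξ := 0) (Or.inl one_ne_zero)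
    rwa [h0, h1] at h
  · have h := fisherPf_pos hn o ho ha hb (ζ := 1) (ξ := 1) (Or.inl one_ne_zero)
    rwa [h1] at h
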